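/- Let $a<b$ be real, $m\in\mathbb N$, and let $H\in L^1([a,b];\mathbb C^{m\times m})$ be pointwise (a.e.) Hermitian positive definite with $H^{-1}\in L^1([a,b];\mathbb C^{m\times m})$. Let $P_0\in L^\infty([a,b];\mathbb C^{m\times m})$ be pointwise dissipative, i.e. $\operatorname{Re} v^*P_0(\xi)v\le 0$ for all $v\in\mathbb C^m$ and a.e. $\xi$, let $P_1\in\mathbb C^{m\times m}$ be Hermitian and invertible, and let $W_B,W_C\in\mathbb C^{m\times 2m}$ satisfy $$\begin{bmatrix}0&I_m\\ I_m&0\end{bmatrix}=\begin{bmatrix}W_B\\ W_C\end{bmatrix}\begin{bmatrix}0&I_m\\ I_m&0\end{bmatrix}\begin{bmatrix}W_B\\ W_C\end{bmatrix}^*.$$ Write $N=\begin{bmatrix}P_1&-P_1\\ I_m&I_m\end{bmatrix}$. Let $M=\begin{bmatrix}F\&G\\ K\&L\end{bmatrix}$ be the operator on $L^2([a,b];\mathbb C^m)\times\mathbb C^m$ with $$\operatorname{dom}M=\Big\{(z,u)\in W^{1,2}([a,b];\mathbb C^m)\times\mathbb C^m:\ \tfrac1{\sqrt2}W_BN\begin{pmatrix}z(b)\\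 z(a)\end{pmatrix}=u\Big\},$$ $$F\&G(z,u)=P_0z+P_1\tfrac{\partial}{\partial\xi}z,\qquad K\&L(z,u)=-\tfrac1{\sqrt2}W_CN\begin{pmatrix}z(b)\\ z(a)\end{pmatrix},$$ with Hilbert space adjoint $M^*$, and let $F$ be its main operator: $\operatorname{dom}F=\{z:(z,0)\in\operatorname{dom}M\}$, $Fz=F\&G(z,0)$. Let $$\mathcal X_h=H^{-1/2}\cdot L^2([a,b];\mathbb C^m),\qquad \mathcal X_h^*=H^{1/2}\cdot L^2([a,b];\mathbb C^m)$$ be the Hilbert spaces of (classes of) measurable functions with inner products $\langle x,z\rangle_{\mathcal X_h}=\int_a^b z^*Hx\,d\xi$ and $\langle x,z\rangle_{\mathcal X_h^*}=\int_a^b z^*H^{-1}x\,d\xi$. Then $\mathcal X_h^*$ is the anti-dual of $\mathcal X_h$ with respect to the duality product $\langle x',x\rangle_{\mathcal X_h^*,\mathcal X_h}=\int_a^b x^*x'\,d\xi$, with Riesz isomorphism $\mathcal R:\mathcal X_h\to\mathcal X_h^*$, $x\mapsto Hx$. A dissipation node on $(\mathcal X_h,\mathbb C^m)$ is a linear operator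 $S:\mathcal X_h^*\times\mathbb C^m\supset\operatorname{dom}S\to\mathcal X_h\times\mathbb C^m$ such that (i) $S$ is closed and dissipative, i.e. for all $(x',u)\in\operatorname{dom}S$ with $S(x',u)=(x,v)$ one has $\operatorname{Re}\big(\langle x',x\rangle_{\mathcal X_h^*,\mathcal X_h}+v^*u\big)\le0$; (ii) the first component of $S$, with domain $\operatorname{dom}S$, is closed; (iii) for every $u\in\mathbb C^m$ there is $x'\in\mathcal X_h^*$ with $(x',u)\in\operatorname{dom}S$; (iv) for the main operator $F_S$ of $S$ (defined on $\{x':(x',0)\in\operatorname{dom}S\}$ by letting $F_Sx'$ be the first component of $S(x',0)$), there is $\lambda\in\mathbb C$ with $\operatorname{Re}\lambda>0$ such that $\lambda\mathcal R^{-1}-F_S$ has dense range in $\mathcal X_h$. The following hold. (a) For all $u\in\mathbb C^m$ there is $z\in C^1([a,b];\mathbb C^m)$ with $(z,u)\in\operatorname{dom}M$. (b) For all $y\in\mathbb C^m$ there is $w\in C^1([a,b];\mathbb C^m)$ with $(w,y)\in\operatorname{dom}M^*$. (c) The space $C^1_0([a,b];\mathbb C^m)$ of continuously differentiable functions vanishing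 at $a$ and $b$ is contained and dense in $\mathcal X_h^*$. Moreover, for $$\mathcal W=\Big\{z\in\mathcal X_h^*\cap C^1([a,b];\mathbb C^m):\ W_BN\begin{pmatrix}z(b)\\ z(a)\end{pmatrix}=0\Big\},$$ one has $\mathcal W\subset\operatorname{dom}F$ and $F\mathcal W\subset\mathcal X_h$, and $(F-\mathcal R^{-1})\mathcal W$ is dense in $\mathcal X_h$. (d) The restriction $\widetilde M$ of $M$ to $\{(z,u)\in(\mathcal X_h^*\times\mathbb C^m)\cap\operatorname{dom}M:\ F\&G(z,u)\in\mathcal X_h\}$ is closable as an operator from a subspace of $\mathcal X_h^*\times\mathbb C^m$ to $\mathcal X_h\times\mathbb C^m$, and its closure is a dissipation node on $(\mathcal X_h,\mathbb C^m)$. -/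

import Mathlib

open MeasureTheory Set Matrix
open scoped ComplexOrder MatrixOrder ContDiff InnerProductSpace

noncomputable section

namespace PHNode

/-- The state fibre `ℂᵐ` with its Euclidean inner product. -/
abbrev Cm (m : ℕ) : Type := EuclideanSpace ℂ (Fin m)

/-- Lebesgue measure on the interval `[a, b]`. -/
abbrev intervalMeasure (a b : ℝ) : Measure ℝ := volume.restrict (Icc a b)

/-- The Hilbert space `L²([a, b]; ℂᵐ)`. -/
abbrev L2 (a b : ℝ) (m : ℕ) : Type := Lp (Cm m) 2 (intervalMeasure a b)

/-- Measurable functions `[a, b] → ℂᵐ` modulo equality almost everywhere: the common ambient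
space of `L²`, the energetic space and its anti-dual. -/
abbrev MeasFun (a b : ℝ) (m : ℕ) : Type := ℝ →ₘ[intervalMeasure a b] Cm m

/-- A square matrix acting on `ℂᵐ`, i.e. `act A x = A x`. -/
abbrev act {m : ℕ} (A : Matrix (Fin m) (Fin m) ℂ) (x : Cm m) : Cm m :=
  Matrix.toEuclideanCLM (n := Fin m) (𝕜 := ℂ) A x

/-- A Hamiltonian density: `H : [a, b] → ℂ^{m×m}` is Hermitian positive definite almost
everywhere, and `H` and its pointwise inverse `H⁻¹` belong to `L¹([a, b]; ℂ^{m×m})`. -/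
structure HamiltonianDensity (a b : ℝ) (m : ℕ) where
  toFun : ℝ → Matrix (Fin m) (Fin m) ℂ
  posDef : ∀ᵐ ξ ∂(intervalMeasure a b), (toFun ξ).PosDef
  integrable : ∀ i j, Integrable (fun ξ => toFun ξ i j) (intervalMeasure a b)
  integrable_inv : ∀ i j, Integrable (fun ξ => (toFun ξ)⁻¹ i j) (intervalMeasure a b)

variable {a b : ℝ} {m : ℕ}

/-- The density `H⁻¹`, again a Hamiltonian density. -/
def HamiltonianDensity.inv (D : HamiltonianDensity a b m) : HamiltonianDensity a b m where
  toFun ξ := (D.toFun ξ)⁻¹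
  posDef := D.posDef.mono fun _ h => h.inv
  integrable := D.integrable_inv
  integrable_inv i j := by
    refine (D.integrable i j).congr (D.posDef.mono fun ξ h => ?_)
    change D.toFun ξ i j = ((D.toFun ξ)⁻¹)⁻¹ i j
    rw [Matrix.nonsing_inv_nonsing_inv _ ((Matrix.isUnit_iff_isUnit_det _).1 h.isUnit)]

/-! ### Pointwise linear algebra -/

theorem act_mul (A B : Matrix (Fin m) (Fin m) ℂ) (x : Cm m) : act (A * B) x = act A (act B x) := by
  simp [act, map_mul]

theorem act_one (x : Cm m) : act (1 : Matrix (Fin m) (Fin m) ℂ) x = x := by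
  simp [act, map_one]

theorem act_add (A : Matrix (Fin m) (Fin m) ℂ) (x y : Cm m) :
    act A (x + y) = act A x + act A y := map_add _ x y

theorem act_smul (A : Matrix (Fin m) (Fin m) ℂ) (c : ℂ) (x : Cm m) :
    act A (c • x) = c • act A x := map_smul _ c x

theorem inner_act_left (A : Matrix (Fin m) (Fin m) ℂ) (x y : Cm m) :
    ⟪act A x, y⟫_ℂ = ⟪x, act Aᴴ y⟫_ℂ := by
  have h : Matrix.toEuclideanCLM (n := Fin m) (𝕜 := ℂ) Aᴴ
      = ContinuousLinearMap.adjoint (Matrix.toEuclideanCLM (n := Fin m) (𝕜 := ℂ) A) := by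
    rw [← ContinuousLinearMap.star_eq_adjoint, ← map_star]; rfl
  rw [act, act, h, ContinuousLinearMap.adjoint_inner_right]

theorem isUnit_sqrt {A : Matrix (Fin m) (Fin m) ℂ} (hA : A.PosDef) : IsUnit (CFC.sqrt A) := by
  have h : CFC.sqrt A * CFC.sqrt A = A := CFC.sqrt_mul_sqrt_self A hA.posSemidef.nonneg
  rw [Matrix.isUnit_iff_isUnit_det]
  have h2 := (Matrix.isUnit_iff_isUnit_det _).1 hA.isUnit
  rw [← h, Matrix.det_mul] at h2
  exact isUnit_of_mul_isUnit_left h2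

theorem sqrt_act_inv {A : Matrix (Fin m) (Fin m) ℂ} (hA : A.PosDef) (x : Cm m) :
    act (CFC.sqrt A) (act (CFC.sqrt A)⁻¹ x) = x := by
  rw [← act_mul, Matrix.mul_nonsing_inv _ ((Matrix.isUnit_iff_isUnit_det _).1 (isUnit_sqrt hA)),
    act_one]

theorem sqrt_inv_act {A : Matrix (Fin m) (Fin m) ℂ} (hA : A.PosDef) (x : Cm m) :
    act (CFC.sqrt A)⁻¹ (act (CFC.sqrt A) x) = x := by
  rw [← act_mul, Matrix.nonsing_inv_mul _ ((Matrix.isUnit_iff_isUnit_det _).1 (isUnit_sqrt hA)),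
    act_one]

theorem act_eq_sqrt {A : Matrix (Fin m) (Fin m) ℂ} (hA : A.PosDef) (x : Cm m) :
    act A x = act (CFC.sqrt A) (act (CFC.sqrt A) x) := by
  rw [← act_mul, CFC.sqrt_mul_sqrt_self A hA.posSemidef.nonneg]

theorem sqrt_conjTranspose (A : Matrix (Fin m) (Fin m) ℂ) : (CFC.sqrt A)ᴴ = CFC.sqrt A :=
  (CFC.sqrt_nonneg A).posSemidef.isHermitian

theorem inner_act_eq {A : Matrix (Fin m) (Fin m) ℂ} (hA : A.PosDef) (f g : Cm m) :
    ⟪act (CFC.sqrt A)⁻¹ f, act A (act (CFC.sqrt A)⁻¹ g)⟫_ℂ = ⟪f, g⟫_ℂ := by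
  rw [act_eq_sqrt hA, sqrt_act_inv hA, ← sqrt_conjTranspose, ← inner_act_left,
    sqrt_conjTranspose, sqrt_act_inv hA]

theorem sqrt_inv_inv {A : Matrix (Fin m) (Fin m) ℂ} (hA : A.PosDef) :
    (CFC.sqrt A⁻¹)⁻¹ = CFC.sqrt A := by
  rw [← hA.posSemidef.inv_sqrt,
    Matrix.nonsing_inv_nonsing_inv _ ((Matrix.isUnit_iff_isUnit_det _).1 (isUnit_sqrt hA))]

open scoped Matrix.Norms.L2Operator in
theorem continuousOn_matrix_sqrt :
    ContinuousOn (CFC.sqrt : Matrix (Fin m) (Fin m) ℂ → Matrix (Fin m) (Fin m) ℂ) {A | 0 ≤ A} :=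
  CFC.continuousOn_sqrt

open scoped Matrix.Norms.L2Operator in
theorem isClosed_matrix_nonneg : IsClosed {A : Matrix (Fin m) (Fin m) ℂ | 0 ≤ A} :=
  isClosed_Ici

/-- The Borel structure on matrices, used only in the measurability proofs below. -/
abbrev matrixMeasurableSpace (m : ℕ) : MeasurableSpace (Matrix (Fin m) (Fin m) ℂ) :=
  inferInstanceAs (MeasurableSpace (Fin m → Fin m → ℂ))

attribute [local instance] matrixMeasurableSpace in
theorem measurable_matrix_sqrt : ∃ F : Matrix (Fin m) (Fin m) ℂ → Matrix (Fin m) (Fin m) ℂ,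
    Measurable F ∧ ∀ A, 0 ≤ A → F A = CFC.sqrt A := by
  have : BorelSpace (Matrix (Fin m) (Fin m) ℂ) := inferInstanceAs (BorelSpace (Fin m → Fin m → ℂ))
  classical
  exact ⟨_, continuousOn_matrix_sqrt.measurable_piecewise (g := fun _ => 0) continuousOn_const
    isClosed_matrix_nonneg.measurableSet, fun A hA => Set.piecewise_eq_of_mem _ _ _ hA⟩

theorem aestronglyMeasurable_act {A : ℝ → Matrix (Fin m) (Fin m) ℂ} {f : ℝ → Cm m}
    {μ : Measure ℝ} (hA : ∀ i j, AEStronglyMeasurable (fun ξ => A ξ i j) μ)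
    (hf : AEStronglyMeasurable f μ) : AEStronglyMeasurable (fun ξ => act (A ξ) (f ξ)) μ := by
  have hcoord : ∀ i, AEStronglyMeasurable (fun ξ => ∑ j, A ξ i j * f ξ j) μ := fun i =>
    Finset.aestronglyMeasurable_fun_sum _ fun j _ => (hA i j).mul
      ((EuclideanSpace.proj (𝕜 := ℂ) j).continuous.comp_aestronglyMeasurable hf)
  have hpi : AEStronglyMeasurable (fun ξ => fun i => ∑ j, A ξ i j * f ξ j) μ :=
    (aemeasurable_pi_lambda _ fun i => (hcoord i).aemeasurable).aestronglyMeasurable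
  exact (PiLp.continuous_toLp 2 _).comp_aestronglyMeasurable hpi

attribute [local instance] matrixMeasurableSpace in
theorem aestronglyMeasurable_sqrt_entry (D : HamiltonianDensity a b m) (i j : Fin m) :
    AEStronglyMeasurable (fun ξ => CFC.sqrt (D.toFun ξ) i j) (intervalMeasure a b) := by
  have hH : AEMeasurable D.toFun (intervalMeasure a b) :=
    aemeasurable_pi_lambda _ fun i => aemeasurable_pi_lambda _ fun j =>
      (D.integrable i j).aestronglyMeasurable.aemeasurable
  obtain ⟨F, hF, hFs⟩ := measurable_matrix_sqrt (m := m)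
  have h1 : AEMeasurable (fun ξ => F (D.toFun ξ)) (intervalMeasure a b) := hF.comp_aemeasurable hH
  have h2 : AEMeasurable (fun ξ => F (D.toFun ξ) i j) (intervalMeasure a b) :=
    (measurable_pi_apply j).comp_aemeasurable ((measurable_pi_apply i).comp_aemeasurable h1)
  refine h2.aestronglyMeasurable.congr (D.posDef.mono fun ξ h => ?_)
  change F (D.toFun ξ) i j = _
  rw [hFs _ h.posSemidef.nonneg]

theorem aestronglyMeasurable_inv_sqrt_act (D : HamiltonianDensity a b m) {f : ℝ → Cm m}
    (hf : AEStronglyMeasurable f (intervalMeasure a b)) :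
    AEStronglyMeasurable (fun ξ => act (CFC.sqrt (D.toFun ξ))⁻¹ (f ξ)) (intervalMeasure a b) := by
  refine aestronglyMeasurable_act (fun i j => ?_) hf
  refine (aestronglyMeasurable_sqrt_entry D.inv i j).congr (D.posDef.mono fun ξ h => ?_)
  change CFC.sqrt (D.toFun ξ)⁻¹ i j = _
  rw [← h.posSemidef.inv_sqrt]

/-! ### The energetic space and its anti-dual -/

/-- The underlying set of `X_h = H^{-1/2} · L²([a, b]; ℂᵐ)`. -/
def energySubmodule (D : HamiltonianDensity a b m) : Submodule ℂ (MeasFun a b m) where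
  carrier := {x | ∃ f : L2 a b m,
    ∀ᵐ ξ ∂(intervalMeasure a b), x ξ = act (CFC.sqrt (D.toFun ξ))⁻¹ (f ξ)}
  zero_mem' := ⟨0, by
    filter_upwards [AEEqFun.coeFn_zero (μ := intervalMeasure a b) (β := Cm m),
      Lp.coeFn_zero (Cm m) 2 (intervalMeasure a b)] with ξ h1 h2
    rw [h1, h2]; simp⟩
  add_mem' := by
    rintro x y ⟨f, hf⟩ ⟨g, hg⟩
    refine ⟨f + g, ?_⟩
    filter_upwards [hf, hg, AEEqFun.coeFn_add x y, Lp.coeFn_add f g] with ξ h1 h2 h3 h4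
    rw [h3, h4, Pi.add_apply, Pi.add_apply, h1, h2, act_add]
  smul_mem' := by
    rintro c x ⟨f, hf⟩
    refine ⟨c • f, ?_⟩
    filter_upwards [hf, AEEqFun.coeFn_smul c x, Lp.coeFn_smul c f] with ξ h1 h2 h3
    rw [h2, h3, Pi.smul_apply, Pi.smul_apply, h1, act_smul]

/-- The energetic space `X_h = H^{-1/2} · L²([a, b]; ℂᵐ)`, a Hilbert space for the inner product
`⟨x, z⟩ = ∫ z(ξ)* H(ξ) x(ξ) dξ`. -/
def EnergySpace (D : HamiltonianDensity a b m) : Type := energySubmodule D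

namespace EnergySpace

variable {D : HamiltonianDensity a b m}

instance : AddCommGroup (EnergySpace D) := inferInstanceAs (AddCommGroup (energySubmodule D))

instance : Module ℂ (EnergySpace D) := inferInstanceAs (Module ℂ (energySubmodule D))

/-- The underlying measurable function of an element of `X_h`. -/
def val (x : EnergySpace D) : MeasFun a b m := Subtype.val x

theorem val_mem (x : EnergySpace D) : x.val ∈ energySubmodule D := Subtype.property x

theorem val_injective : Function.Injective (val : EnergySpace D → MeasFun a b m) :=
  Subtype.val_injective

@[simp] theorem val_add (x y : EnergySpace D) : (x + y).val = x.val + y.val := rfl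

@[simp] theorem val_smul (c : ℂ) (x : EnergySpace D) : (c • x).val = c • x.val := rfl

theorem coe_add (x y : EnergySpace D) :
    ∀ᵐ ξ ∂(intervalMeasure a b), (x + y).val ξ = x.val ξ + y.val ξ :=
  AEEqFun.coeFn_add x.val y.val

theorem coe_smul (c : ℂ) (x : EnergySpace D) :
    ∀ᵐ ξ ∂(intervalMeasure a b), (c • x).val ξ = c • x.val ξ :=
  AEEqFun.coeFn_smul c x.val

/-- The `L²` function `H^{1/2} x` for `x ∈ X_h`. -/
def toL2Fun (x : EnergySpace D) : L2 a b m := x.val_mem.choose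

theorem toL2Fun_spec (x : EnergySpace D) : ∀ᵐ ξ ∂(intervalMeasure a b),
    x.val ξ = act (CFC.sqrt (D.toFun ξ))⁻¹ (x.toL2Fun ξ) := x.val_mem.choose_spec

theorem toL2Fun_eq (x : EnergySpace D) : ∀ᵐ ξ ∂(intervalMeasure a b),
    x.toL2Fun ξ = act (CFC.sqrt (D.toFun ξ)) (x.val ξ) := by
  filter_upwards [x.toL2Fun_spec, D.posDef] with ξ h hp
  rw [h, sqrt_act_inv hp]

/-- The linear map `x ↦ H^{1/2} x` from `X_h` to `L²`. -/
def toL2 : EnergySpace D →ₗ[ℂ] L2 a b m where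
  toFun := toL2Fun
  map_add' x y := by
    apply Lp.ext
    filter_upwards [(x + y).toL2Fun_eq, x.toL2Fun_eq, y.toL2Fun_eq, coe_add x y,
      Lp.coeFn_add x.toL2Fun y.toL2Fun] with ξ h1 h2 h3 h4 h5
    rw [h1, h5, Pi.add_apply, h2, h3, h4, act_add]
  map_smul' c x := by
    apply Lp.ext
    filter_upwards [(c • x).toL2Fun_eq, x.toL2Fun_eq, coe_smul c x,
      Lp.coeFn_smul c x.toL2Fun] with ξ h1 h2 h3 h4
    rw [h1, RingHom.id_apply, h4, Pi.smul_apply, h2, h3, act_smul]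

theorem toL2_injective : Function.Injective (toL2 : EnergySpace D →ₗ[ℂ] L2 a b m) := by
  intro x y hxy
  apply val_injective
  apply AEEqFun.ext
  have hxy' : x.toL2Fun = y.toL2Fun := hxy
  filter_upwards [x.toL2Fun_spec, y.toL2Fun_spec] with ξ h1 h2
  rw [h1, h2, hxy']

/-- In Mathlib's convention the inner product is conjugate linear in its first argument:
`⟪x, z⟫ = ∫ x(ξ)* H(ξ) z(ξ) dξ`. -/
instance : Inner ℂ (EnergySpace D) :=
  ⟨fun x z => ∫ ξ, ⟪x.val ξ, act (D.toFun ξ) (z.val ξ)⟫_ℂ ∂(intervalMeasure a b)⟩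

theorem inner_def (x z : EnergySpace D) : ⟪x, z⟫_ℂ =
    ∫ ξ, ⟪x.val ξ, act (D.toFun ξ) (z.val ξ)⟫_ℂ ∂(intervalMeasure a b) := rfl

theorem inner_eq_toL2 (x z : EnergySpace D) : ⟪x, z⟫_ℂ = ⟪toL2 x, toL2 z⟫_ℂ := by
  rw [inner_def, MeasureTheory.L2.inner_def]
  refine integral_congr_ae ?_
  filter_upwards [x.toL2Fun_spec, z.toL2Fun_spec, D.posDef] with ξ h1 h2 hp
  rw [h1, h2, inner_act_eq hp]
  rfl

abbrev core : InnerProductSpace.Core ℂ (EnergySpace D) where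
  conj_inner_symm x y := by rw [inner_eq_toL2, inner_eq_toL2, inner_conj_symm]
  re_inner_nonneg x := by rw [inner_eq_toL2]; exact inner_self_nonneg
  add_left x y z := by rw [inner_eq_toL2, map_add, inner_add_left, ← inner_eq_toL2, ← inner_eq_toL2]
  smul_left x y r := by rw [inner_eq_toL2, map_smul, inner_smul_left, ← inner_eq_toL2]
  definite x h := by
    rw [inner_eq_toL2, inner_self_eq_zero] at h
    exact toL2_injective (h.trans (map_zero _).symm)

instance : NormedAddCommGroup (EnergySpace D) := core.toNormedAddCommGroup

instance : InnerProductSpace ℂ (EnergySpace D) := InnerProductSpace.ofCore core.toCore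

theorem norm_toL2 (x : EnergySpace D) : ‖toL2 x‖ = ‖x‖ := by
  rw [@norm_eq_sqrt_re_inner ℂ, @norm_eq_sqrt_re_inner ℂ (EnergySpace D), inner_eq_toL2]

theorem toL2_surjective : Function.Surjective (toL2 : EnergySpace D →ₗ[ℂ] L2 a b m) := by
  intro f
  let x : MeasFun a b m := AEEqFun.mk (fun ξ => act (CFC.sqrt (D.toFun ξ))⁻¹ (f ξ))
    (aestronglyMeasurable_inv_sqrt_act D (Lp.aestronglyMeasurable f))
  have hx : ∀ᵐ ξ ∂(intervalMeasure a b), x ξ = act (CFC.sqrt (D.toFun ξ))⁻¹ (f ξ) :=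
    AEEqFun.coeFn_mk _ _
  let X : EnergySpace D := ⟨x, f, hx⟩
  refine ⟨X, Lp.ext ?_⟩
  filter_upwards [X.toL2Fun_eq, hx, D.posDef] with ξ h1 h2 hp
  change X.toL2Fun ξ = f ξ
  rw [h1]
  change act _ (x ξ) = _
  rw [h2, sqrt_act_inv hp]

/-- `H^{1/2} : X_h → L²` is an isometric isomorphism. -/
def toL2Equiv (D : HamiltonianDensity a b m) : EnergySpace D ≃ₗᵢ[ℂ] L2 a b m :=
  LinearIsometryEquiv.mk (LinearEquiv.ofBijective toL2 ⟨toL2_injective, toL2_surjective⟩) norm_toL2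

instance : CompleteSpace (EnergySpace D) :=
  (toL2Equiv D).toIsometryEquiv.completeSpace

end EnergySpace

/-- The anti-dual `X_h* = H^{1/2} · L²([a, b]; ℂᵐ)` of `X_h` with respect to the pivot space `L²`,
with the inner product `⟨x, z⟩ = ∫ z(ξ)* H(ξ)⁻¹ x(ξ) dξ`; it is the energetic space of `H⁻¹`. -/
abbrev DualEnergySpace (D : HamiltonianDensity a b m) : Type := EnergySpace D.inv

/-- `X_h* = H^{1/2} · L²`. -/
theorem mem_energySubmodule_inv (D : HamiltonianDensity a b m) (x : MeasFun a b m) :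
    x ∈ energySubmodule D.inv ↔ ∃ f : L2 a b m,
      ∀ᵐ ξ ∂(intervalMeasure a b), x ξ = act (CFC.sqrt (D.toFun ξ)) (f ξ) := by
  refine exists_congr fun f => Filter.eventually_congr ?_
  filter_upwards [D.posDef] with ξ hp
  change x ξ = act (CFC.sqrt (D.toFun ξ)⁻¹)⁻¹ (f ξ) ↔ _
  rw [sqrt_inv_inv hp]

/-- The inner product of `X_h*` in Mathlib's convention. -/
theorem dual_inner_def (D : HamiltonianDensity a b m) (x z : DualEnergySpace D) : ⟪x, z⟫_ℂ =
    ∫ ξ, ⟪x.val ξ, act (D.toFun ξ)⁻¹ (z.val ξ)⟫_ℂ ∂(intervalMeasure a b) := rfl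

/-- A realization of the anti-dual of the Hilbert space `X` as a Hilbert space `X'`: a duality
product `⟨x', x⟩`, linear in `x' ∈ X'` and antilinear in `x ∈ X`, and the Riesz isomorphism, a
unitary map `R : X → X'` with `⟨R x, y⟩ = ⟨x, y⟩_X`. Since `R` is unitary, `x' ↦ ⟨x', ·⟩` is then
an isometric isomorphism of `X'` onto the space of continuous antilinear functionals on `X`. -/
structure AntiDual (X X' : Type*) [NormedAddCommGroup X] [InnerProductSpace ℂ X]
    [NormedAddCommGroup X'] [InnerProductSpace ℂ X'] where
  pairing : X' → X → ℂ
  riesz : X ≃ₗᵢ[ℂ] X'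
  pairing_riesz : ∀ x y : X, pairing (riesz x) y = ⟪y, x⟫_ℂ

/-- Multiplication by `H`, as a map `X_h → X_h*`. -/
def rieszFun (D : HamiltonianDensity a b m) (x : EnergySpace D) : DualEnergySpace D :=
  ⟨AEEqFun.mk (fun ξ => act (D.toFun ξ) (x.val ξ))
    (aestronglyMeasurable_act (fun i j => (D.integrable i j).aestronglyMeasurable)
      x.val.aestronglyMeasurable), by
    rw [mem_energySubmodule_inv]
    refine ⟨x.toL2Fun, ?_⟩
    filter_upwards [AEEqFun.coeFn_mk (μ := intervalMeasure a b)
      (fun ξ => act (D.toFun ξ) (x.val ξ)) (aestronglyMeasurable_act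
        (fun i j => (D.integrable i j).aestronglyMeasurable) x.val.aestronglyMeasurable),
      x.toL2Fun_eq, D.posDef] with ξ h1 h2 hp
    rw [h1, h2, act_eq_sqrt hp]⟩

theorem rieszFun_val (D : HamiltonianDensity a b m) (x : EnergySpace D) :
    ∀ᵐ ξ ∂(intervalMeasure a b), (rieszFun D x).val ξ = act (D.toFun ξ) (x.val ξ) :=
  AEEqFun.coeFn_mk _ _

theorem toL2_rieszFun (D : HamiltonianDensity a b m) (x : EnergySpace D) :
    EnergySpace.toL2 (rieszFun D x) = EnergySpace.toL2 x := by
  apply Lp.ext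
  filter_upwards [(rieszFun D x).toL2Fun_eq, x.toL2Fun_eq, rieszFun_val D x, D.posDef]
    with ξ h1 h2 h3 hp
  change (rieszFun D x).toL2Fun ξ = x.toL2Fun ξ
  rw [h1, h2, h3]
  change act (CFC.sqrt (D.toFun ξ)⁻¹) _ = _
  rw [act_eq_sqrt hp, ← hp.posSemidef.inv_sqrt, sqrt_inv_act hp]

/-- Multiplication by `H`, as a linear map `X_h → X_h*`. -/
def rieszLin (D : HamiltonianDensity a b m) : EnergySpace D →ₗ[ℂ] DualEnergySpace D where
  toFun := rieszFun D
  map_add' x y := EnergySpace.toL2_injective (by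
    rw [toL2_rieszFun, map_add, map_add, toL2_rieszFun, toL2_rieszFun])
  map_smul' c x := EnergySpace.toL2_injective (by
    rw [toL2_rieszFun, map_smul, RingHom.id_apply, map_smul, toL2_rieszFun])

theorem rieszLin_bijective (D : HamiltonianDensity a b m) : Function.Bijective (rieszLin D) := by
  have key : ∀ x, EnergySpace.toL2 (rieszLin D x) = EnergySpace.toL2 x := toL2_rieszFun D
  refine ⟨fun x y h => EnergySpace.toL2_injective ?_, fun y => ?_⟩
  · rw [← key x, ← key y, h]
  · obtain ⟨x, hx⟩ := EnergySpace.toL2_surjective (D := D) (EnergySpace.toL2 y)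
    exact ⟨x, EnergySpace.toL2_injective ((key x).trans hx)⟩

theorem norm_rieszLin (D : HamiltonianDensity a b m) (x : EnergySpace D) :
    ‖rieszLin D x‖ = ‖x‖ := by
  have key : EnergySpace.toL2 (rieszLin D x) = EnergySpace.toL2 x := toL2_rieszFun D x
  rw [← EnergySpace.norm_toL2 x, ← key, EnergySpace.norm_toL2]

/-- The Riesz isomorphism `X_h → X_h*`, `x ↦ H x`. -/
def riesz (D : HamiltonianDensity a b m) : EnergySpace D ≃ₗᵢ[ℂ] DualEnergySpace D :=
  LinearIsometryEquiv.mk (LinearEquiv.ofBijective (rieszLin D) (rieszLin_bijective D))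
    (norm_rieszLin D)

theorem riesz_val (D : HamiltonianDensity a b m) (x : EnergySpace D) :
    ∀ᵐ ξ ∂(intervalMeasure a b), (riesz D x).val ξ = act (D.toFun ξ) (x.val ξ) :=
  rieszFun_val D x

/-- `X_h*` as the anti-dual of `X_h`: the duality product is `⟨x', x⟩ = ∫ x(ξ)* x'(ξ) dξ`, and the
Riesz isomorphism is multiplication by `H`. -/
def energyAntiDual (D : HamiltonianDensity a b m) :
    AntiDual (EnergySpace D) (DualEnergySpace D) where
  pairing x' x := ∫ ξ, ⟪x.val ξ, x'.val ξ⟫_ℂ ∂(intervalMeasure a b)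
  riesz := riesz D
  pairing_riesz x y := by
    rw [EnergySpace.inner_def]
    refine integral_congr_ae ?_
    filter_upwards [riesz_val D x] with ξ h
    rw [h]

/-! ### Operators on product spaces and dissipation nodes -/

section Nodes

variable {X X' U : Type*} [NormedAddCommGroup X] [InnerProductSpace ℂ X]
  [NormedAddCommGroup X'] [InnerProductSpace ℂ X'] [NormedAddCommGroup U] [InnerProductSpace ℂ U]

/-- Partially defined linear operators `X' × U ⊃ dom M → X × U`, where the products are Hilbert
space products and the Hilbert space `U` is identified with its anti-dual. -/
abbrev NodeOp (X' X U : Type*) [NormedAddCommGroup X] [InnerProductSpace ℂ X]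
    [NormedAddCommGroup X'] [InnerProductSpace ℂ X'] [NormedAddCommGroup U]
    [InnerProductSpace ℂ U] : Type _ :=
  WithLp 2 (X' × U) →ₗ.[ℂ] WithLp 2 (X × U)

/-- The first block row `F&G = P_X M`, with domain `dom M`. -/
def firstRow (M : NodeOp X' X U) : WithLp 2 (X' × U) →ₗ.[ℂ] X :=
  (WithLp.fstₗ 2 ℂ X U).compPMap M

/-- The embedding `x' ↦ (x', 0)`. -/
def inlMap (X' U : Type*) [NormedAddCommGroup X'] [InnerProductSpace ℂ X']
    [NormedAddCommGroup U] [InnerProductSpace ℂ U] : X' →ₗ[ℂ] WithLp 2 (X' × U) :=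
  (WithLp.linearEquiv 2 ℂ (X' × U)).symm.toLinearMap ∘ₗ LinearMap.inl ℂ X' U

/-- The main operator `F x' = P_X M (x', 0)`, with domain `{x' | (x', 0) ∈ dom M}`. -/
def mainOperator (M : NodeOp X' X U) : X' →ₗ.[ℂ] X where
  domain := M.domain.comap (inlMap X' U)
  toFun := (WithLp.fstₗ 2 ℂ X U) ∘ₗ M.toFun ∘ₗ
    (inlMap X' U).restrict (p := M.domain.comap (inlMap X' U)) (q := M.domain) fun _ h => h

/-- `M` is a dissipation node on `(X, U)`, where `X'` realizes the anti-dual of `X`. -/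
structure IsDissipationNode (P : AntiDual X X') (M : NodeOp X' X U) : Prop where
  isClosed : M.IsClosed
  dissipative : ∀ w : M.domain,
    (P.pairing (w : WithLp 2 (X' × U)).fst (M w).fst
      + ⟪(M w).snd, (w : WithLp 2 (X' × U)).snd⟫_ℂ).re ≤ 0
  isClosed_firstRow : (firstRow M).IsClosed
  exists_mem : ∀ u : U, ∃ x' : X', WithLp.toLp 2 (x', u) ∈ M.domain
  dense_range : ∃ c : ℂ, 0 < c.re ∧
    DenseRange fun x' : (mainOperator M).domain =>
      c • P.riesz.symm (x' : X') - mainOperator M x'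

end Nodes

/-! ### The boundary control operator on `L²([a, b]; ℂᵐ) × ℂᵐ` -/

/-- `g` is the weak derivative of `z` on `(a, b)`. -/
def HasWeakDeriv (z g : L2 a b m) : Prop :=
  ∀ φ : ℝ → ℝ, ContDiff ℝ ∞ φ → HasCompactSupport φ → tsupport φ ⊆ Ioo a b →
    ∫ ξ, deriv φ ξ • z ξ ∂(intervalMeasure a b) = -∫ ξ, φ ξ • g ξ ∂(intervalMeasure a b)

/-- `z ∈ W^{1,2}([a, b]; ℂᵐ)` with weak derivative `g ∈ L²` and continuous representative `ζ`.
Boundary values of `z` are those of `ζ`. -/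
structure IsSobolev (z g : L2 a b m) (ζ : ℝ → Cm m) : Prop where
  continuousOn : ContinuousOn ζ (Icc a b)
  ae_eq : ∀ᵐ ξ ∂(intervalMeasure a b), z ξ = ζ ξ
  weakDeriv : HasWeakDeriv z g

/-- The vector `W [P₁, -P₁; I, I] (zb; za)`. -/
def boundaryVec (P₁ : Matrix (Fin m) (Fin m) ℂ) (W : Matrix (Fin m) (Fin m ⊕ Fin m) ℂ)
    (zb za : Cm m) : Cm m :=
  WithLp.toLp 2 (W *ᵥ (Matrix.fromBlocks P₁ (-P₁) 1 1 *ᵥ Sum.elim (fun i => zb i) (fun i => za i)))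

theorem boundaryVec_add (P₁ : Matrix (Fin m) (Fin m) ℂ) (W : Matrix (Fin m) (Fin m ⊕ Fin m) ℂ)
    (x y x' y' : Cm m) :
    boundaryVec P₁ W (x + x') (y + y') = boundaryVec P₁ W x y + boundaryVec P₁ W x' y' := by
  simp only [boundaryVec]
  rw [← WithLp.toLp_add 2 (W *ᵥ _), ← Matrix.mulVec_add, ← Matrix.mulVec_add]
  congr 3
  ext (i | i) <;> simp

theorem boundaryVec_smul (P₁ : Matrix (Fin m) (Fin m) ℂ) (W : Matrix (Fin m) (Fin m ⊕ Fin m) ℂ)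
    (c : ℂ) (x y : Cm m) :
    boundaryVec P₁ W (c • x) (c • y) = c • boundaryVec P₁ W x y := by
  simp only [boundaryVec]
  rw [← WithLp.toLp_smul 2 c (W *ᵥ _), ← Matrix.mulVec_smul, ← Matrix.mulVec_smul]
  congr 3
  ext (i | i) <;> simp

theorem integrable_test_smul {φ : ℝ → ℝ} (hφ : Continuous φ) (f : L2 a b m) :
    Integrable (fun ξ => φ ξ • f ξ) (intervalMeasure a b) := by
  have hf : IntegrableOn f (Icc a b) := (Lp.memLp f).integrable (by norm_num)
  exact hf.continuousOn_smul hφ.continuousOn isCompact_Icc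

theorem HasWeakDeriv.add {z g z' g' : L2 a b m} (h : HasWeakDeriv z g) (h' : HasWeakDeriv z' g') :
    HasWeakDeriv (z + z') (g + g') := by
  intro φ h1 h2 h3
  have hd : Continuous (deriv φ) := h1.continuous_deriv (by simp)
  have e1 : ∫ ξ, deriv φ ξ • (z + z') ξ ∂(intervalMeasure a b) =
      ∫ ξ, (deriv φ ξ • z ξ + deriv φ ξ • z' ξ) ∂(intervalMeasure a b) :=
    integral_congr_ae ((Lp.coeFn_add z z').mono fun ξ h => by
      simp only [h, Pi.add_apply, smul_add])
  have e2 : ∫ ξ, φ ξ • (g + g') ξ ∂(intervalMeasure a b) =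
      ∫ ξ, (φ ξ • g ξ + φ ξ • g' ξ) ∂(intervalMeasure a b) :=
    integral_congr_ae ((Lp.coeFn_add g g').mono fun ξ h => by
      simp only [h, Pi.add_apply, smul_add])
  rw [e1, e2, integral_add (integrable_test_smul hd z) (integrable_test_smul hd z'),
    integral_add (integrable_test_smul h1.continuous g) (integrable_test_smul h1.continuous g'),
    h φ h1 h2 h3, h' φ h1 h2 h3]
  abel

theorem HasWeakDeriv.smul {z g : L2 a b m} (h : HasWeakDeriv z g) (c : ℂ) :
    HasWeakDeriv (c • z) (c • g) := by
  intro φ h1 h2 h3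
  have e1 : ∫ ξ, deriv φ ξ • (c • z) ξ ∂(intervalMeasure a b) =
      ∫ ξ, c • deriv φ ξ • z ξ ∂(intervalMeasure a b) :=
    integral_congr_ae ((Lp.coeFn_smul c z).mono fun ξ h => by
      simp only [h, Pi.smul_apply]; exact smul_comm _ _ _)
  have e2 : ∫ ξ, φ ξ • (c • g) ξ ∂(intervalMeasure a b) =
      ∫ ξ, c • φ ξ • g ξ ∂(intervalMeasure a b) :=
    integral_congr_ae ((Lp.coeFn_smul c g).mono fun ξ h => by
      simp only [h, Pi.smul_apply]; exact smul_comm _ _ _)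
  rw [e1, e2, integral_smul, integral_smul, h φ h1 h2 h3, smul_neg]

theorem IsSobolev.add {z g z' g' : L2 a b m} {ζ ζ' : ℝ → Cm m} (h : IsSobolev z g ζ)
    (h' : IsSobolev z' g' ζ') : IsSobolev (z + z') (g + g') (ζ + ζ') where
  continuousOn := h.continuousOn.add h'.continuousOn
  ae_eq := by
    filter_upwards [h.ae_eq, h'.ae_eq, Lp.coeFn_add z z'] with ξ h1 h2 h3
    rw [h3, Pi.add_apply, Pi.add_apply, h1, h2]
  weakDeriv := h.weakDeriv.add h'.weakDeriv

theorem IsSobolev.smul {z g : L2 a b m} {ζ : ℝ → Cm m} (h : IsSobolev z g ζ) (c : ℂ) :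
    IsSobolev (c • z) (c • g) (c • ζ) where
  continuousOn := h.continuousOn.const_smul c
  ae_eq := by
    filter_upwards [h.ae_eq, Lp.coeFn_smul c z] with ξ h1 h3
    rw [h3, Pi.smul_apply, Pi.smul_apply, h1]
  weakDeriv := h.weakDeriv.smul c

/-- The graph of `M = [F&G; K&L]`: all `((z, u), (f, v))` with `z ∈ W^{1,2}([a, b]; ℂᵐ)`,
`u = (1/√2) W_B [P₁, -P₁; I, I] (z(b); z(a))`, `f = P₀ z + P₁ ∂z/∂ξ ∈ L²` and
`v = -(1/√2) W_C [P₁, -P₁; I, I] (z(b); z(a))`. -/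
def portGraph (a b : ℝ) {m : ℕ} (P₀ : ℝ → Matrix (Fin m) (Fin m) ℂ)
    (P₁ : Matrix (Fin m) (Fin m) ℂ) (W_B W_C : Matrix (Fin m) (Fin m ⊕ Fin m) ℂ) :
    Submodule ℂ (WithLp 2 (L2 a b m × Cm m) × WithLp 2 (L2 a b m × Cm m)) where
  carrier := {p | ∃ (g : L2 a b m) (ζ : ℝ → Cm m), IsSobolev p.1.fst g ζ ∧
    p.1.snd = ((1 / √2 : ℝ) : ℂ) • boundaryVec P₁ W_B (ζ b) (ζ a) ∧
    (∀ᵐ ξ ∂(intervalMeasure a b), p.2.fst ξ = act (P₀ ξ) (p.1.fst ξ) + act P₁ (g ξ)) ∧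
    p.2.snd = -(((1 / √2 : ℝ) : ℂ) • boundaryVec P₁ W_C (ζ b) (ζ a))}
  zero_mem' := by
    have hz := Lp.coeFn_zero (Cm m) 2 (intervalMeasure a b)
    have hb : ∀ W : Matrix (Fin m) (Fin m ⊕ Fin m) ℂ, boundaryVec P₁ W (0 : Cm m) 0 = 0 := fun W => by
      simpa using boundaryVec_smul P₁ W 0 0 0
    refine ⟨0, 0, ⟨continuousOn_const, ?_, ?_⟩, ?_, ?_, ?_⟩
    · exact hz
    · intro φ _ _ _
      rw [integral_eq_zero_of_ae, integral_eq_zero_of_ae, neg_zero]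
      · filter_upwards [hz] with ξ h; rw [h]; simp
      · filter_upwards [hz] with ξ h
        change deriv φ ξ • (0 : L2 a b m) ξ = 0
        rw [h]; simp
    · change (0 : Cm m) = _
      simp [hb]
    · filter_upwards [hz] with ξ h
      change (0 : L2 a b m) ξ = act (P₀ ξ) ((0 : L2 a b m) ξ) + act P₁ ((0 : L2 a b m) ξ)
      rw [h]; simp
    · change (0 : Cm m) = _
      simp [hb]
  add_mem' := by
    rintro p q ⟨g, ζ, h1, h2, h3, h4⟩ ⟨g', ζ', h1', h2', h3', h4'⟩
    refine ⟨g + g', ζ + ζ', h1.add h1', ?_, ?_, ?_⟩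
    · change p.1.snd + q.1.snd = _
      rw [h2, h2', Pi.add_apply, Pi.add_apply, boundaryVec_add, smul_add]
    · filter_upwards [h3, h3', Lp.coeFn_add p.1.fst q.1.fst, Lp.coeFn_add p.2.fst q.2.fst,
        Lp.coeFn_add g g'] with ξ e1 e2 e3 e4 e5
      change (p.2.fst + q.2.fst) ξ = act (P₀ ξ) ((p.1.fst + q.1.fst) ξ) + act P₁ ((g + g') ξ)
      rw [e3, e4, e5, Pi.add_apply, Pi.add_apply, Pi.add_apply, e1, e2, act_add, act_add]
      abel
    · change p.2.snd + q.2.snd = _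
      rw [h4, h4', Pi.add_apply, Pi.add_apply, boundaryVec_add, smul_add, neg_add]
  smul_mem' := by
    rintro c p ⟨g, ζ, h1, h2, h3, h4⟩
    refine ⟨c • g, c • ζ, h1.smul c, ?_, ?_, ?_⟩
    · change c • p.1.snd = _
      rw [h2, Pi.smul_apply, Pi.smul_apply, boundaryVec_smul, smul_comm]
    · filter_upwards [h3, Lp.coeFn_smul c p.1.fst, Lp.coeFn_smul c p.2.fst,
        Lp.coeFn_smul c g] with ξ e1 e3 e4 e5
      change (c • p.2.fst) ξ = act (P₀ ξ) ((c • p.1.fst) ξ) + act P₁ ((c • g) ξ)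
      rw [e3, e4, e5, Pi.smul_apply, Pi.smul_apply, Pi.smul_apply, e1, act_smul, act_smul, smul_add]
    · change c • p.2.snd = _
      rw [h4, Pi.smul_apply, Pi.smul_apply, boundaryVec_smul, smul_neg, smul_comm]

/-- The operator `M = [F&G; K&L]` on `L²([a, b]; ℂᵐ) × ℂᵐ` with graph `portGraph`. -/
def portOperator (a b : ℝ) {m : ℕ} (P₀ : ℝ → Matrix (Fin m) (Fin m) ℂ)
    (P₁ : Matrix (Fin m) (Fin m) ℂ) (W_B W_C : Matrix (Fin m) (Fin m ⊕ Fin m) ℂ) :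
    NodeOp (L2 a b m) (L2 a b m) (Cm m) :=
  (portGraph a b P₀ P₁ W_B W_C).toLinearPMap

theorem HasWeakDeriv.eq_zero {g : L2 a b m} (h : HasWeakDeriv 0 g) : g = 0 := by
  have hg : IntegrableOn g (Icc a b) := (Lp.memLp g).integrable (by norm_num)
  have key : ∀ᵐ ξ ∂(volume : Measure ℝ), ξ ∈ Ioo a b → g ξ = 0 := by
    refine isOpen_Ioo.ae_eq_zero_of_integral_contDiff_smul_eq_zero
      ((hg.mono_set Ioo_subset_Icc_self).locallyIntegrableOn) fun φ h1 h2 h3 => ?_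
    have h4 := h φ h1 h2 h3
    rw [integral_eq_zero_of_ae (by
      filter_upwards [Lp.coeFn_zero (Cm m) 2 (intervalMeasure a b)] with ξ h; rw [h]; simp),
      eq_comm, neg_eq_zero] at h4
    rw [← h4, setIntegral_eq_integral_of_forall_compl_eq_zero]
    intro ξ hξ
    have : φ ξ = 0 := image_eq_zero_of_notMem_tsupport fun hx => hξ (Ioo_subset_Icc_self (h3 hx))
    rw [this, zero_smul]
  apply Lp.ext
  have h5 : ∀ᵐ ξ ∂(intervalMeasure a b), g ξ = 0 := by
    change ∀ᵐ ξ ∂(volume.restrict (Icc a b)), g ξ = 0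
    rw [← restrict_Ioo_eq_restrict_Icc, ae_restrict_iff' measurableSet_Ioo]
    exact key
  filter_upwards [h5, Lp.coeFn_zero (Cm m) 2 (intervalMeasure a b)] with ξ h6 h7
  rw [h6, h7]; rfl

/-- `portGraph` is single-valued, hence it is the graph of `portOperator`. -/
theorem graph_portOperator (hab : a < b) (P₀ : ℝ → Matrix (Fin m) (Fin m) ℂ)
    (P₁ : Matrix (Fin m) (Fin m) ℂ) (W_B W_C : Matrix (Fin m) (Fin m ⊕ Fin m) ℂ) :
    (portOperator a b P₀ P₁ W_B W_C).graph = portGraph a b P₀ P₁ W_B W_C := by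
  refine Submodule.toLinearPMap_graph_eq _ ?_
  rintro ⟨p, q⟩ ⟨g, ζ, h1, -, h3, h4⟩ hp
  change p = 0 at hp
  subst hp
  have hz := Lp.coeFn_zero (Cm m) 2 (intervalMeasure a b)
  have hg : g = 0 := HasWeakDeriv.eq_zero h1.weakDeriv
  have hζ : EqOn ζ 0 (Icc a b) := by
    have : ζ =ᵐ[intervalMeasure a b] 0 := by
      filter_upwards [h1.ae_eq, hz] with ξ e1 e2
      rw [← e1]; exact e2
    exact Measure.eqOn_Icc_of_ae_eq volume hab.ne this h1.continuousOn continuousOn_const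
  have hb : boundaryVec P₁ W_C (0 : Cm m) 0 = 0 := by
    simpa using boundaryVec_smul P₁ W_C 0 0 0
  have hq1 : q.fst = 0 := by
    apply Lp.ext
    filter_upwards [h3, hz] with ξ e1 e2
    change q.fst ξ = act (P₀ ξ) ((0 : L2 a b m) ξ) + act P₁ (g ξ) at e1
    rw [e1, hg, e2]; simp
  have hq2 : q.snd = 0 := by
    change q.snd = _ at h4
    rw [h4, hζ (right_mem_Icc.2 hab.le), hζ (left_mem_Icc.2 hab.le)]
    simp [hb]
  change q = 0
  rw [← WithLp.toLp_ofLp 2 q]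
  have : q.ofLp = 0 := Prod.ext hq1 hq2
  rw [this]; rfl

/-! ### The restriction to the energetic space -/

/-- The graph of `M` restricted to `{(z, u) ∈ dom M | z ∈ X_h*, F&G (z, u) ∈ X_h}`, as a subspace
of `(X_h* × ℂᵐ) × (X_h × ℂᵐ)`. -/
def restrictGraph (D : HamiltonianDensity a b m) (M : NodeOp (L2 a b m) (L2 a b m) (Cm m)) :
    Submodule ℂ (WithLp 2 (DualEnergySpace D × Cm m) × WithLp 2 (EnergySpace D × Cm m)) where
  carrier := {p | ∃ q ∈ M.graph,
    (q.1.fst : MeasFun a b m) = p.1.fst.val ∧ q.1.snd = p.1.snd ∧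
    (q.2.fst : MeasFun a b m) = p.2.fst.val ∧ q.2.snd = p.2.snd}
  zero_mem' := ⟨0, M.graph.zero_mem, rfl, rfl, rfl, rfl⟩
  add_mem' := by
    rintro p p' ⟨q, hq, h1, h2, h3, h4⟩ ⟨q', hq', h1', h2', h3', h4'⟩
    refine ⟨q + q', M.graph.add_mem hq hq', ?_, ?_, ?_, ?_⟩
    · exact congrArg₂ (· + ·) h1 h1'
    · exact congrArg₂ (· + ·) h2 h2'
    · exact congrArg₂ (· + ·) h3 h3'
    · exact congrArg₂ (· + ·) h4 h4'
  smul_mem' := by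
    rintro c p ⟨q, hq, h1, h2, h3, h4⟩
    refine ⟨c • q, M.graph.smul_mem c hq, ?_, ?_, ?_, ?_⟩
    · exact congrArg (c • ·) h1
    · exact congrArg (c • ·) h2
    · exact congrArg (c • ·) h3
    · exact congrArg (c • ·) h4

/-- The restriction of `M` to `{(z, u) ∈ dom M | z ∈ X_h*, F&G (z, u) ∈ X_h}`, regarded as an
operator `X_h* × ℂᵐ → X_h × ℂᵐ`. -/
def restrictOperator (D : HamiltonianDensity a b m) (M : NodeOp (L2 a b m) (L2 a b m) (Cm m)) :
    NodeOp (DualEnergySpace D) (EnergySpace D) (Cm m) :=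
  (restrictGraph D M).toLinearPMap

theorem graph_restrictOperator (D : HamiltonianDensity a b m)
    (M : NodeOp (L2 a b m) (L2 a b m) (Cm m)) :
    (restrictOperator D M).graph = restrictGraph D M := by
  refine Submodule.toLinearPMap_graph_eq _ ?_
  rintro ⟨p, p'⟩ ⟨⟨q, q'⟩, hq, h1, h2, h3, h4⟩ hp
  change p = 0 at hp
  subst hp
  have hq0 : q = 0 := by
    rw [← WithLp.toLp_ofLp 2 q]
    have : q.ofLp = 0 := Prod.ext (Subtype.ext h1) h2
    rw [this]; rfl
  have hq0' : q' = 0 := M.graph_fst_eq_zero_snd hq hq0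
  subst hq0'
  change p' = 0
  rw [← WithLp.toLp_ofLp 2 p']
  have : p'.ofLp = 0 := Prod.ext (EnergySpace.val_injective h3.symm) h4.symm
  rw [this]; rfl

/-! ### Continuously differentiable functions -/

/-- `z` is (the class of) the continuously differentiable function `ζ : [a, b] → ℂᵐ`. -/
structure IsC1Rep (z : MeasFun a b m) (ζ : ℝ → Cm m) : Prop where
  contDiffOn : ContDiffOn ℝ 1 ζ (Icc a b)
  ae_eq : ∀ᵐ ξ ∂(intervalMeasure a b), z ξ = ζ ξ

/-- The space `C¹([a, b]; ℂᵐ)`. -/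
def C1 (a b : ℝ) (m : ℕ) : Set (MeasFun a b m) := {z | ∃ ζ, IsC1Rep z ζ}

/-- The space `C¹₀([a, b]; ℂᵐ)` of continuously differentiable functions vanishing at `a` and
`b`. -/
def C1Zero (a b : ℝ) (m : ℕ) : Set (MeasFun a b m) := {z | ∃ ζ, IsC1Rep z ζ ∧ ζ a = 0 ∧ ζ b = 0}

/-- The space `W = {z ∈ X_h* ∩ C¹([a, b]; ℂᵐ) | W_B [P₁, -P₁; I, I] (z(b); z(a)) = 0}`. -/
def homogeneousC1 (D : HamiltonianDensity a b m) (P₁ : Matrix (Fin m) (Fin m) ℂ)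
    (W_B : Matrix (Fin m) (Fin m ⊕ Fin m) ℂ) : Set (DualEnergySpace D) :=
  {z | ∃ ζ, IsC1Rep z.val ζ ∧ boundaryVec P₁ W_B (ζ b) (ζ a) = 0}

end PHNode

end

/-! Everything rests on one Green identity. Write `B w` and `C w` for `W_B N (w(b); w(a))` and `W_C
N (w(b); w(a))`, and `J` for the block swap. Since `W = [W_B; W_C]` is square, `W J W* = J` also
gives `W* J W = J`; together with `P₁* = P₁` this turns the boundary term `w* P₁ z |ₐᵇ` of an
integration by parts into `(⟪B w, C z⟫ + ⟪C w, B z⟫) / 2` (`inner_boundaryVec`,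
`integral_inner_act_add`). The identity is proved for absolutely continuous functions with
derivative merely in `L¹`, because the argument for (c) leaves `L²`.

(a) and (b): `W` and `N` are invertible, so an affine function can have any prescribed `B` and `C`
(`exists_contDiff_boundaryVec`). By Green's identity every `C¹` function `w` gives an element `(w, B
w / √2)` of `dom M*`, on which `M*` acts by `P₀* w - P₁ w'` and `C w / √2`.

(c): `H, H⁻¹ ∈ L¹` say that `H^{1/2}` and `H^{-1/2}` are square integrable, so bounded functions lie
in both energy spaces and elements of both are integrable. Density of `C¹₀` then follows from the
fundamental lemma of the calculus of variations. For the range, let `x ∈ X_h` be orthogonal to `(F -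
R⁻¹) W`, and put `w = H x ∈ L¹`. Test functions show that `P₁ w' = P₀* w - x` weakly, so `w` is
absolutely continuous by du Bois-Reymond. Elements of `W` with nonzero boundary values force `B w =
0`. Green's identity for `w` against itself now gives `‖x‖² = Re ∫ w* x = Re ∫ w* P₀* w ≤ 0`
(`integral_re_inner_le_of_weak`, `dense_rangeSubmodule`).

(d): Green's identity and `Re v* P₀ v ≤ 0` make the restriction of `M` dissipative, and (a) and (c)
provide a dense domain, all inputs and the range condition with `λ = 1`. The rest is abstract
(`isDissipationNode_closure`): a densely defined dissipative operator is closable, and for a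
dissipative operator with all inputs the output is bounded by state, input and first row, so the
first row of the closure is closed. -/

noncomputable section

namespace PHNode

/-! ### Absolutely continuous functions with `L¹` derivative; du Bois-Reymond lemma -/

section Primitives

variable {E F G : Type*} [NormedAddCommGroup E] [NormedSpace ℝ E]
  [NormedAddCommGroup F] [NormedSpace ℝ F] [NormedAddCommGroup G] [NormedSpace ℝ G]
  {a b : ℝ}

/-- `f` is absolutely continuous on `[a, b]` with derivative `p ∈ L¹`. -/
structure HasL1Deriv (a b : ℝ) (f p : ℝ → E) : Prop where
  integrable : Integrable p (intervalMeasure a b)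
  eq_add : ∀ t ∈ Icc a b, f t = f a + ∫ s in a..t, p s

namespace HasL1Deriv

theorem intervalIntegrable (hab : a ≤ b) {f p : ℝ → E} (h : HasL1Deriv a b f p) :
    IntervalIntegrable p volume a b :=
  (intervalIntegrable_iff_integrableOn_Icc_of_le hab).2 h.integrable

theorem intervalIntegrable_of_mem (hab : a ≤ b) {f p : ℝ → E} (h : HasL1Deriv a b f p) {s t : ℝ}
    (hs : s ∈ Icc a b) (ht : t ∈ Icc a b) : IntervalIntegrable p volume s t :=
  (h.intervalIntegrable hab).mono_set (by
    rw [uIcc_of_le hab]; exact (uIcc_subset_Icc hs ht))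

theorem sub_eq (hab : a ≤ b) {f p : ℝ → E} (h : HasL1Deriv a b f p) {s t : ℝ}
    (hs : s ∈ Icc a b) (ht : t ∈ Icc a b) : f t - f s = ∫ r in s..t, p r := by
  have ha := left_mem_Icc.2 hab
  rw [h.eq_add t ht, h.eq_add s hs, add_sub_add_left_eq_sub,
    intervalIntegral.integral_interval_sub_left (h.intervalIntegrable_of_mem hab ha ht)
      (h.intervalIntegrable_of_mem hab ha hs)]

/-- The increments of `f` are dominated by those of the primitive of `‖p‖`, a real function whose
absolute continuity is known. -/
theorem absolutelyContinuousOnInterval (hab : a ≤ b) {f p : ℝ → E} (h : HasL1Deriv a b f p) :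
    AbsolutelyContinuousOnInterval f a b := by
  have hn := (h.intervalIntegrable hab).norm.absolutelyContinuousOnInterval_intervalIntegral
    (c := a) left_mem_uIcc
  rw [absolutelyContinuousOnInterval_iff] at hn ⊢
  intro ε hε
  obtain ⟨δ, hδ, H⟩ := hn ε hε
  refine ⟨δ, hδ, fun I hI hlt => lt_of_le_of_lt (Finset.sum_le_sum fun i hi => ?_) (H I hI hlt)⟩
  have hmem := hI.1 i hi
  rw [uIcc_of_le hab] at hmem
  have ha := left_mem_Icc.2 hab
  rw [dist_comm, dist_comm (∫ v in a..(I.2 i).1, ‖p v‖), dist_eq_norm, dist_eq_norm,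
    h.sub_eq hab hmem.1 hmem.2, intervalIntegral.integral_interval_sub_left
      (h.intervalIntegrable_of_mem hab ha hmem.2).norm
      (h.intervalIntegrable_of_mem hab ha hmem.1).norm]
  exact intervalIntegral.norm_integral_le_abs_integral_norm

theorem continuousOn (hab : a ≤ b) {f p : ℝ → E} (h : HasL1Deriv a b f p) :
    ContinuousOn f (Icc a b) := by
  have := (h.absolutelyContinuousOnInterval hab).continuousOn
  rwa [uIcc_of_le hab] at this

theorem ae_hasDerivAt [CompleteSpace E] (hab : a ≤ b) {f p : ℝ → E} (h : HasL1Deriv a b f p) :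
    ∀ᵐ x, x ∈ uIcc a b → HasDerivAt f (p x) x := by
  -- `f` is a primitive on `[a, b]` only, so nothing is known about its two-sided derivative at the
  -- endpoints; they form a null set.
  have h₁ : ∀ᵐ x : ℝ, x ≠ a := by simp [ae_iff, measure_singleton]
  have h₂ : ∀ᵐ x : ℝ, x ≠ b := by simp [ae_iff, measure_singleton]
  filter_upwards [(h.intervalIntegrable hab).ae_hasDerivAt_integral, h₁, h₂] with x hx hxa hxb hmem
  have h3 := (hx hmem a left_mem_uIcc).const_add (f a)
  rw [uIcc_of_le hab] at hmem
  refine h3.congr_of_eventuallyEq ?_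
  filter_upwards [Icc_mem_nhds (lt_of_le_of_ne hmem.1 hxa.symm) (lt_of_le_of_ne hmem.2 hxb)]
    with t ht using h.eq_add t ht

theorem congr_right {f p q : ℝ → E} (h : HasL1Deriv a b f p)
    (hpq : p =ᵐ[intervalMeasure a b] q) : HasL1Deriv a b f q where
  integrable := h.integrable.congr hpq
  eq_add t ht := by
    rw [h.eq_add t ht]
    congr 1
    refine intervalIntegral.integral_congr_ae_restrict ?_
    refine ae_restrict_of_ae_restrict_of_subset ?_ hpq
    rw [uIoc_of_le ht.1]
    exact Ioc_subset_Icc_self.trans (Icc_subset_Icc_right ht.2)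

theorem clm_comp [CompleteSpace E] [CompleteSpace F] (hab : a ≤ b) {f p : ℝ → E}
    (h : HasL1Deriv a b f p) (L : E →L[ℝ] F) :
    HasL1Deriv a b (fun t => L (f t)) (fun t => L (p t)) where
  integrable := L.integrable_comp h.integrable
  eq_add t ht := by
    rw [h.eq_add t ht, map_add, ← L.intervalIntegral_comp_comm
      (h.intervalIntegrable_of_mem hab (left_mem_Icc.2 hab) ht)]

theorem _root_.ContDiffOn.hasL1Deriv [CompleteSpace E] (hab : a ≤ b) {f : ℝ → E}
    (hf : ContDiffOn ℝ 1 f (Icc a b)) : HasL1Deriv a b f (derivWithin f (Icc a b)) := by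
  rcases hab.eq_or_lt with rfl | hlt
  · refine ⟨?_, fun t ht => ?_⟩
    · have : intervalMeasure a a = 0 := by simp [intervalMeasure]
      rw [this]; exact integrable_zero_measure
    · have : t = a := by simpa using ht
      subst this; simp
  have hc : ContinuousOn (derivWithin f (Icc a b)) (Icc a b) :=
    hf.continuousOn_derivWithin (uniqueDiffOn_Icc hlt) le_rfl
  refine ⟨hc.integrableOn_Icc, fun t ht => ?_⟩
  have h1 := intervalIntegral.integral_eq_sub_of_hasDeriv_right_of_le ht.1
    (hf.continuousOn.mono (Icc_subset_Icc_right ht.2)) (f' := derivWithin f (Icc a b))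
    (fun x hx => ?_) ((hc.mono (by
      rw [uIcc_of_le ht.1]; exact Icc_subset_Icc_right ht.2)).intervalIntegrable)
  · rw [h1]; abel
  · have hx' : x ∈ Icc a b := ⟨hx.1.le, hx.2.le.trans ht.2⟩
    exact (((hf.differentiableOn one_ne_zero x hx').hasDerivWithinAt).hasDerivAt
      (Icc_mem_nhds hx.1 (hx.2.trans_le ht.2))).hasDerivWithinAt

end HasL1Deriv

/-- The increment splits as `B (f, Δg) + B (Δf, g)`, and absolutely continuous functions are
bounded. -/
theorem _root_.IsBoundedBilinearMap.absolutelyContinuousOnInterval {B : E × F → G}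
    (hB : IsBoundedBilinearMap ℝ B) {f : ℝ → E} {g : ℝ → F}
    (hf : AbsolutelyContinuousOnInterval f a b) (hg : AbsolutelyContinuousOnInterval g a b) :
    AbsolutelyContinuousOnInterval (fun t => B (f t, g t)) a b := by
  obtain ⟨C, hC⟩ := hf.exists_bound
  obtain ⟨D, hD⟩ := hg.exists_bound
  obtain ⟨K, hK, hKB⟩ := hB.bound
  unfold AbsolutelyContinuousOnInterval at hf hg
  apply squeeze_zero' ?_ ?_
    (by simpa using! (hg.const_mul (K * C)).add (hf.const_mul (K * D)))
  · exact Filter.Eventually.of_forall fun _ => Finset.sum_nonneg fun _ _ => dist_nonneg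
  rw [Filter.eventually_inf_principal]
  filter_upwards with I hI
  rw [Finset.mul_sum, Finset.mul_sum, ← Finset.sum_add_distrib]
  gcongr with i hi
  have h1 := hI.1 i hi
  have e : B (f (I.2 i).1, g (I.2 i).1) - B (f (I.2 i).2, g (I.2 i).2) =
      B (f (I.2 i).1, g (I.2 i).1 - g (I.2 i).2) + B (f (I.2 i).1 - f (I.2 i).2, g (I.2 i).2) := by
    rw [hB.map_sub_right, hB.map_sub_left]; abel
  rw [dist_eq_norm, dist_eq_norm, dist_eq_norm, e]
  refine (norm_add_le _ _).trans (add_le_add ((hKB _ _).trans ?_) ((hKB _ _).trans ?_))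
  · gcongr
    exact hC _ h1.1
  · rw [mul_assoc, mul_assoc, mul_comm ‖f _ - f _‖]
    gcongr
    exact hD _ h1.2

/-- The difference of `B (f, g)` and the primitive of the expected derivative is absolutely
continuous with derivative zero almost everywhere, hence constant. This product rule is the source
of every integration by parts below. -/
theorem _root_.IsBoundedBilinearMap.hasL1Deriv [CompleteSpace E] [CompleteSpace F]
    [CompleteSpace G] {B : E × F → G} (hB : IsBoundedBilinearMap ℝ B) (hab : a ≤ b)
    {f p : ℝ → E} {g q : ℝ → F} (hf : HasL1Deriv a b f p) (hg : HasL1Deriv a b g q) :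
    HasL1Deriv a b (fun t => B (f t, g t)) (fun t => B (f t, q t) + B (p t, g t)) := by
  have hfa := hf.absolutelyContinuousOnInterval hab
  have hga := hg.absolutelyContinuousOnInterval hab
  have hi : Integrable (fun t => B (f t, q t) + B (p t, g t)) (intervalMeasure a b) := by
    obtain ⟨C, hC⟩ := hfa.exists_bound
    obtain ⟨D, hD⟩ := hga.exists_bound
    obtain ⟨K, hK, hKB⟩ := hB.bound
    have hfc := (hf.continuousOn hab).aestronglyMeasurable (μ := volume) measurableSet_Icc
    have hgc := (hg.continuousOn hab).aestronglyMeasurable (μ := volume) measurableSet_Icc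
    rw [uIcc_of_le hab] at hC hD
    refine Integrable.add ?_ ?_
    · refine (hg.integrable.norm.const_mul (K * C)).mono'
        (hB.continuous.comp_aestronglyMeasurable (hfc.prodMk hg.integrable.aestronglyMeasurable)) ?_
      refine (ae_restrict_mem measurableSet_Icc).mono fun t ht => (hKB _ _).trans ?_
      gcongr
      exact hC t ht
    · refine (hf.integrable.norm.const_mul (K * D)).mono'
        (hB.continuous.comp_aestronglyMeasurable (hf.integrable.aestronglyMeasurable.prodMk hgc)) ?_
      refine (ae_restrict_mem measurableSet_Icc).mono fun t ht => (hKB _ _).trans ?_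
      rw [mul_assoc, mul_assoc, mul_comm ‖p t‖]
      gcongr
      exact hD t ht
  set r := fun t => B (f t, q t) + B (p t, g t) with hr
  have hprim : HasL1Deriv a b (fun t => ∫ s in a..t, r s) r := ⟨hi, fun t _ => by simp⟩
  have hac := (hB.absolutelyContinuousOnInterval hfa hga).sub
    (hprim.absolutelyContinuousOnInterval hab)
  obtain ⟨C, hC⟩ := hac.const_of_ae_hasDerivAt_zero (by
    filter_upwards [hf.ae_hasDerivAt hab, hg.ae_hasDerivAt hab, hprim.ae_hasDerivAt hab]
      with x h1 h2 h3 hx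
    have h4 := ((hB.hasFDerivAt (f x, g x)).comp_hasDerivAt x ((h1 hx).prodMk (h2 hx))).sub (h3 hx)
    simpa [hr, IsBoundedBilinearMap.deriv_apply] using! h4)
  rw [uIcc_of_le hab] at hC
  refine ⟨hi, fun t ht => ?_⟩
  have h1 := hC t ht
  have h2 := hC a (left_mem_Icc.2 hab)
  simp only [Pi.sub_apply, intervalIntegral.integral_same, sub_zero] at h1 h2
  rw [h2, ← h1]; abel

theorem HasL1Deriv.setIntegral_eq_sub (hab : a ≤ b) {f p : ℝ → E} (h : HasL1Deriv a b f p) :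
    ∫ ξ, p ξ ∂(intervalMeasure a b) = f b - f a := by
  rw [h.sub_eq hab (left_mem_Icc.2 hab) (right_mem_Icc.2 hab),
    intervalIntegral.integral_of_le hab, ← integral_Icc_eq_integral_Ioc]

theorem _root_.ContDiff.hasL1Deriv_deriv [CompleteSpace E] {f : ℝ → E} (hf : ContDiff ℝ 1 f) :
    HasL1Deriv a b f (deriv f) where
  integrable := (hf.continuous_deriv_one).continuousOn.integrableOn_Icc
  eq_add t _ := by
    rw [intervalIntegral.integral_deriv_eq_sub
      (fun x _ => (hf.differentiable one_ne_zero).differentiableAt)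
      (hf.continuous_deriv_one.intervalIntegrable _ _)]
    abel

theorem eq_zero_of_tsupport_subset {φ : ℝ → ℝ} {s : Set ℝ} (h : tsupport φ ⊆ s) {x : ℝ}
    (hx : x ∉ s) : φ x = 0 :=
  image_eq_zero_of_notMem_tsupport fun h' => hx (h h')

/-- Integration by parts against test functions. -/
theorem HasL1Deriv.integral_deriv_smul [CompleteSpace E] (hab : a ≤ b) {f p : ℝ → E}
    (h : HasL1Deriv a b f p) {φ : ℝ → ℝ} (hφ : ContDiff ℝ 1 φ) (hs : tsupport φ ⊆ Ioo a b) :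
    ∫ ξ, deriv φ ξ • f ξ ∂(intervalMeasure a b) = -∫ ξ, φ ξ • p ξ ∂(intervalMeasure a b) := by
  have h1 := ((isBoundedBilinearMap_smul (𝕜 := ℝ) (A := ℝ) (E := E)).hasL1Deriv hab
    (hφ.hasL1Deriv_deriv (a := a) (b := b)) h).setIntegral_eq_sub hab
  have h2 : Integrable (fun ξ => φ ξ • p ξ) (intervalMeasure a b) :=
    IntegrableOn.continuousOn_smul h.integrable hφ.continuous.continuousOn isCompact_Icc
  have h3 : Integrable (fun ξ => deriv φ ξ • f ξ) (intervalMeasure a b) :=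
    (hφ.continuous_deriv_one.continuousOn.smul (h.continuousOn hab)).integrableOn_Icc
  simp only at h1
  rw [integral_add h2 h3, eq_zero_of_tsupport_subset hs (x := b) (by simp),
    eq_zero_of_tsupport_subset hs (x := a) (by simp), zero_smul, zero_smul, sub_zero] at h1
  rw [eq_neg_iff_add_eq_zero, add_comm]; exact h1

/-- A smooth test function in `(a, b)` with vanishing integral is the derivative of a smooth test
function. -/
theorem exists_test_deriv_eq {θ : ℝ → ℝ} (hθ : ContDiff ℝ ∞ θ)
    (hc : HasCompactSupport θ) (hs : tsupport θ ⊆ Ioo a b) (h0 : ∫ ξ, θ ξ = 0) :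
    ∃ φ : ℝ → ℝ, ContDiff ℝ ∞ φ ∧ HasCompactSupport φ ∧ tsupport φ ⊆ Ioo a b ∧ deriv φ = θ := by
  rcases (tsupport θ).eq_empty_or_nonempty with he | hne
  · rw [tsupport_eq_empty_iff] at he
    subst he
    refine ⟨0, contDiff_const, HasCompactSupport.zero, by simp, by ext; simp⟩
  -- With `[c, d]` the hull of the support, the primitive from `a` vanishes to the left of `c`
  -- because the integrand does, and to the right of `d` because the total integral is zero.
  obtain ⟨c, hcK, hcl⟩ := hc.isCompact.exists_isLeast hne
  obtain ⟨d, hdK, hdl⟩ := hc.isCompact.exists_isGreatest hne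
  have hd : deriv (fun t => ∫ s in a..t, θ s) = θ :=
    funext fun t => hθ.continuous.deriv_integral θ a t
  have hsupp : tsupport (fun t => ∫ s in a..t, θ s) ⊆ Icc c d := by
    refine closure_minimal (fun t ht => ?_) isClosed_Icc
    by_contra hn
    refine ht ?_
    rcases lt_or_ge t c with h | h
    · refine intervalIntegral.integral_zero_ae (ae_of_all _ fun s hs' => ?_)
      refine image_eq_zero_of_notMem_tsupport fun h' => ?_
      have h1 := hcl h'
      rcases le_total a t with hat | hat
      · rw [uIoc_of_le hat] at hs'
        exact absurd (h1.trans hs'.2) (not_le.2 h)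
      · rw [uIoc_of_ge hat] at hs'
        exact absurd (h1.trans hs'.2) (not_le.2 (hs hcK).1)
    · have h2 : d < t := not_le.1 fun h' => hn ⟨h, h'⟩
      change ∫ s in a..t, θ s = 0
      rw [intervalIntegral.integral_eq_integral_of_support_subset, h0]
      intro s hs'
      exact ⟨(hs (subset_tsupport θ hs')).1, (hdl (subset_tsupport θ hs')).trans h2.le⟩
  refine ⟨_, ?_, isCompact_Icc.of_isClosed_subset (isClosed_tsupport _) hsupp,
    hsupp.trans (Icc_subset_Ioo (hs hcK).1 (hs hdK).2), hd⟩
  rw [contDiff_infty_iff_deriv, hd]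
  exact ⟨fun t => (hθ.continuous.integral_hasStrictDerivAt a t).hasDerivAt.differentiableAt, hθ⟩

/-- The du Bois-Reymond lemma. -/
theorem exists_ae_eq_const_of_integral_deriv_smul [CompleteSpace E] (hab : a < b) {f : ℝ → E}
    (hf : Integrable f (intervalMeasure a b))
    (H : ∀ φ : ℝ → ℝ, ContDiff ℝ ∞ φ → HasCompactSupport φ → tsupport φ ⊆ Ioo a b →
      ∫ ξ, deriv φ ξ • f ξ ∂(intervalMeasure a b) = 0) :
    ∃ c : E, ∀ᵐ ξ ∂(intervalMeasure a b), f ξ = c := by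
  -- `ψ` is a fixed test function of integral one, and the constant is `c = ∫ ψ f`. For every test
  -- function `η`, `η - (∫ η) ψ` has integral zero, so it is the derivative of a test function; the
  -- hypothesis then reads `∫ η (f - c) = 0`.
  let B : ContDiffBump ((a + b) / 2) := ⟨(b - a) / 8, (b - a) / 4, by linarith, by linarith⟩
  let ψ : ℝ → ℝ := B.normed volume
  have hψ : ContDiff ℝ ∞ ψ := B.contDiff_normed
  have hψc : HasCompactSupport ψ := B.hasCompactSupport_normed
  have hψ1 : ∫ ξ, ψ ξ = 1 := B.integral_normed
  have hψs : tsupport ψ ⊆ Ioo a b := by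
    change tsupport (B.normed volume) ⊆ _
    rw [B.tsupport_normed_eq, Real.closedBall_eq_Icc]
    change Icc ((a + b) / 2 - (b - a) / 4) ((a + b) / 2 + (b - a) / 4) ⊆ _
    exact Icc_subset_Ioo (by linarith) (by linarith)
  have hint : ∀ {φ : ℝ → ℝ}, Continuous φ → ∀ {g : ℝ → E}, Integrable g (intervalMeasure a b) →
      Integrable (fun ξ => φ ξ • g ξ) (intervalMeasure a b) := fun hφ _ hg =>
    IntegrableOn.continuousOn_smul hg hφ.continuousOn isCompact_Icc
  set c : E := ∫ ξ, ψ ξ • f ξ ∂(intervalMeasure a b) with hcdef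
  have hfc : Integrable (fun ξ => f ξ - c) (intervalMeasure a b) := hf.sub (integrable_const c)
  refine ⟨c, ?_⟩
  have key : ∀ᵐ ξ ∂(volume : Measure ℝ), ξ ∈ Ioo a b → f ξ - c = 0 := by
    refine isOpen_Ioo.ae_eq_zero_of_integral_contDiff_smul_eq_zero
      (IntegrableOn.mono_set hfc Ioo_subset_Icc_self).locallyIntegrableOn fun η h1 h2 h3 => ?_
    have hηI : ∫ ξ, η ξ ∂(intervalMeasure a b) = ∫ ξ, η ξ :=
      setIntegral_eq_integral_of_forall_compl_eq_zero fun ξ hξ =>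
        eq_zero_of_tsupport_subset (h3.trans Ioo_subset_Icc_self) hξ
    set I : ℝ := ∫ ξ, η ξ with hI
    obtain ⟨φ, e1, e2, e3, e4⟩ := exists_test_deriv_eq (θ := fun ξ => η ξ - I * ψ ξ)
      (a := a) (b := b) (h1.sub (contDiff_const.mul hψ)) (h2.sub (hψc.mul_left))
      ((tsupport_sub η _).trans
        (union_subset h3 ((tsupport_mul_subset_right).trans hψs))) (by
        rw [integral_sub (h1.continuous.integrable_of_hasCompactSupport h2)
          ((hψ.continuous.integrable_of_hasCompactSupport hψc).const_mul I), integral_const_mul,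
          hψ1, ← hI]; ring)
    have h4 := H φ e1 e2 e3
    rw [e4] at h4
    rw [← setIntegral_eq_integral_of_forall_compl_eq_zero (s := Icc a b) fun ξ hξ => by
      rw [eq_zero_of_tsupport_subset (h3.trans Ioo_subset_Icc_self) hξ, zero_smul]]
    have h5 : ∫ ξ, (η ξ • f ξ - I • ψ ξ • f ξ) ∂(intervalMeasure a b) = 0 := by
      rw [← h4]
      exact integral_congr_ae (ae_of_all _ fun ξ => by simp only [sub_smul, mul_smul])
    have h6 : ∫ ξ, (I • ψ ξ • f ξ) ∂(intervalMeasure a b) = I • c := integral_smul I _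
    have h7 : Integrable (fun ξ => I • ψ ξ • f ξ) (intervalMeasure a b) :=
      (hint hψ.continuous hf).smul I
    rw [integral_sub (hint h1.continuous hf) h7, h6] at h5
    simp only [smul_sub]
    rw [integral_sub (hint h1.continuous hf) (hint h1.continuous (integrable_const c)),
      integral_smul_const, hηI]
    exact h5
  change ∀ᵐ ξ ∂(volume.restrict (Icc a b)), f ξ = c
  rw [← restrict_Ioo_eq_restrict_Icc, ae_restrict_iff' measurableSet_Ioo]
  exact key.mono fun ξ h hξ => sub_eq_zero.1 (h hξ)

/-- An integrable function with integrable weak derivative is absolutely continuous. -/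
theorem exists_hasL1Deriv_of_integral_deriv_smul [CompleteSpace E] (hab : a < b) {f p : ℝ → E}
    (hf : Integrable f (intervalMeasure a b)) (hp : Integrable p (intervalMeasure a b))
    (H : ∀ φ : ℝ → ℝ, ContDiff ℝ ∞ φ → HasCompactSupport φ → tsupport φ ⊆ Ioo a b →
      ∫ ξ, deriv φ ξ • f ξ ∂(intervalMeasure a b) = -∫ ξ, φ ξ • p ξ ∂(intervalMeasure a b)) :
    ∃ F : ℝ → E, HasL1Deriv a b F p ∧ ∀ᵐ ξ ∂(intervalMeasure a b), f ξ = F ξ := by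
  have hP : ∀ c : E, HasL1Deriv a b (fun t => c + ∫ s in a..t, p s) p :=
    fun c => ⟨hp, fun t _ => by simp⟩
  have hPc := ((hP 0).continuousOn hab.le)
  have hPi : Integrable (fun t => 0 + ∫ s in a..t, p s) (intervalMeasure a b) :=
    hPc.integrableOn_Icc
  -- Subtracting a primitive of `p` leaves a function with weak derivative zero.
  obtain ⟨c, hc⟩ := exists_ae_eq_const_of_integral_deriv_smul hab (hf.sub hPi)
    fun φ h1 h2 h3 => by
      have h4 := (hP 0).integral_deriv_smul hab.le (h1.of_le (by exact_mod_cast le_top)) h3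
      have hd : Continuous (deriv φ) := h1.continuous_deriv (by simp)
      simp only [Pi.sub_apply, smul_sub]
      rw [integral_sub (IntegrableOn.continuousOn_smul hf hd.continuousOn isCompact_Icc)
        (IntegrableOn.continuousOn_smul hPi hd.continuousOn isCompact_Icc), h4, H φ h1 h2 h3,
        sub_self]
  refine ⟨_, hP c, hc.mono fun ξ h => ?_⟩
  rw [← h, Pi.sub_apply]
  abel

end Primitives

/-! ### From Sobolev functions to primitives and back -/

variable {a b : ℝ} {m : ℕ}

/-- The weak derivative provides some absolutely continuous representative. It agrees with the given
continuous `ζ` almost everywhere, hence on all of `[a, b]`; in particular the boundary values of `ζ`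
are the ones that enter integration by parts. -/
theorem IsSobolev.hasL1Deriv (hab : a < b) {z g : L2 a b m} {ζ : ℝ → Cm m}
    (h : IsSobolev z g ζ) : HasL1Deriv a b ζ g := by
  have hz : Integrable z (intervalMeasure a b) := (Lp.memLp z).integrable (by norm_num)
  have hg : Integrable g (intervalMeasure a b) := (Lp.memLp g).integrable (by norm_num)
  obtain ⟨F, hF, hzF⟩ := exists_hasL1Deriv_of_integral_deriv_smul hab hz hg h.weakDeriv
  have he : EqOn ζ F (Icc a b) := by
    refine Measure.eqOn_Icc_of_ae_eq volume hab.ne ?_ h.continuousOn (hF.continuousOn hab.le)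
    filter_upwards [h.ae_eq, hzF] with ξ e1 e2
    rw [← e1, e2]
  refine ⟨hg, fun t ht => ?_⟩
  rw [he ht, he (left_mem_Icc.2 hab.le), hF.eq_add t ht]

theorem HasL1Deriv.isSobolev (hab : a ≤ b) {z g : L2 a b m} {ζ p : ℝ → Cm m}
    (h : HasL1Deriv a b ζ p) (hz : ∀ᵐ ξ ∂(intervalMeasure a b), z ξ = ζ ξ)
    (hg : ∀ᵐ ξ ∂(intervalMeasure a b), g ξ = p ξ) : IsSobolev z g ζ where
  continuousOn := h.continuousOn hab
  ae_eq := hz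
  weakDeriv φ h1 h2 h3 := by
    have h4 := h.integral_deriv_smul hab (h1.of_le (by exact_mod_cast le_top)) h3
    refine (integral_congr_ae (hz.mono fun ξ e => ?_)).trans
      (h4.trans (congrArg Neg.neg (integral_congr_ae (hg.mono fun ξ e => ?_))))
    · simp only [e]
    · simp only [e]

/-! ### Boundary values and Green's identity -/

/-- The boundary values `[P₁, -P₁; I, I] (zb; za)`. -/
def boundaryTrace (P₁ : Matrix (Fin m) (Fin m) ℂ) (zb za : Cm m) : Fin m ⊕ Fin m → ℂ :=
  Sum.elim (P₁ *ᵥ (zb.ofLp - za.ofLp)) (zb.ofLp + za.ofLp)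

theorem boundaryVec_eq (P₁ : Matrix (Fin m) (Fin m) ℂ) (W : Matrix (Fin m) (Fin m ⊕ Fin m) ℂ)
    (zb za : Cm m) : boundaryVec P₁ W zb za = WithLp.toLp 2 (W *ᵥ boundaryTrace P₁ zb za) := by
  rw [boundaryVec, boundaryTrace, Matrix.fromBlocks_mulVec]
  congr 3
  · change P₁ *ᵥ zb.ofLp + -P₁ *ᵥ za.ofLp = _
    rw [Matrix.neg_mulVec, Matrix.mulVec_sub, sub_eq_add_neg]
  · change 1 *ᵥ zb.ofLp + 1 *ᵥ za.ofLp = _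
    rw [Matrix.one_mulVec, Matrix.one_mulVec]

theorem act_eq_toLp (A : Matrix (Fin m) (Fin m) ℂ) (x : Cm m) :
    act A x = WithLp.toLp 2 (A *ᵥ x.ofLp) := rfl

/-- The first block gives `zb - za` after applying `P₁⁻¹` and the second gives `zb + za`; half sum
and half difference recover the two values. -/
theorem boundaryTrace_surjective {P₁ : Matrix (Fin m) (Fin m) ℂ} (hP₁ : IsUnit P₁)
    (v : Fin m ⊕ Fin m → ℂ) : ∃ zb za : Cm m, boundaryTrace P₁ zb za = v := by
  have hdet := (Matrix.isUnit_iff_isUnit_det _).1 hP₁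
  let α : Fin m → ℂ := P₁⁻¹ *ᵥ (v ∘ Sum.inl)
  let β : Fin m → ℂ := v ∘ Sum.inr
  refine ⟨WithLp.toLp 2 ((1 / 2 : ℂ) • (β + α)), WithLp.toLp 2 ((1 / 2 : ℂ) • (β - α)), ?_⟩
  have h1 : (1 / 2 : ℂ) • (β + α) - (1 / 2 : ℂ) • (β - α) = α := by
    ext i; simp; ring
  have h2 : (1 / 2 : ℂ) • (β + α) + (1 / 2 : ℂ) • (β - α) = β := by
    ext i; simp; ring
  rw [boundaryTrace, h1, h2]
  change Sum.elim (P₁ *ᵥ P₁⁻¹ *ᵥ (v ∘ Sum.inl)) (v ∘ Sum.inr) = v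
  rw [Matrix.mulVec_mulVec, Matrix.mul_nonsing_inv _ hdet, Matrix.one_mulVec,
    Sum.elim_comp_inl_inr]

theorem fromBlocks_swap_mul_self :
    (Matrix.fromBlocks 0 1 1 0 : Matrix (Fin m ⊕ Fin m) (Fin m ⊕ Fin m) ℂ) *
      Matrix.fromBlocks 0 1 1 0 = 1 := by
  rw [Matrix.fromBlocks_multiply]; simp

theorem fromBlocks_swap_mulVec (v : Fin m ⊕ Fin m → ℂ) :
    (Matrix.fromBlocks 0 1 1 0 : Matrix (Fin m ⊕ Fin m) (Fin m ⊕ Fin m) ℂ) *ᵥ v =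
      Sum.elim (v ∘ Sum.inr) (v ∘ Sum.inl) := by
  rw [Matrix.fromBlocks_mulVec]; simp

section Unitary

variable {W_B W_C : Matrix (Fin m) (Fin m ⊕ Fin m) ℂ}
    (hW : (Matrix.fromBlocks 0 1 1 0 : Matrix (Fin m ⊕ Fin m) (Fin m ⊕ Fin m) ℂ) =
      Matrix.fromRows W_B W_C * Matrix.fromBlocks 0 1 1 0 * (Matrix.fromRows W_B W_C)ᴴ)

include hW

/-- `W J W* = J` and `J² = 1` make `J W* J` a right inverse of `W`, so both boundary vectors can be
prescribed simultaneously. -/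
theorem exists_boundaryVec_eq {P₁ : Matrix (Fin m) (Fin m) ℂ} (hP₁ : IsUnit P₁) (u v : Cm m) :
    ∃ zb za : Cm m, boundaryVec P₁ W_B zb za = u ∧ boundaryVec P₁ W_C zb za = v := by
  have h1 : Matrix.fromRows W_B W_C * (Matrix.fromBlocks 0 1 1 0 * (Matrix.fromRows W_B W_C)ᴴ *
      Matrix.fromBlocks 0 1 1 0) = 1 := by
    rw [← Matrix.mul_assoc, ← Matrix.mul_assoc, ← hW, fromBlocks_swap_mul_self]
  obtain ⟨zb, za, h⟩ := boundaryTrace_surjective hP₁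
    ((Matrix.fromBlocks 0 1 1 0 * (Matrix.fromRows W_B W_C)ᴴ * Matrix.fromBlocks 0 1 1 0) *ᵥ
      Sum.elim u.ofLp v.ofLp)
  have h2 : Sum.elim (W_B *ᵥ boundaryTrace P₁ zb za) (W_C *ᵥ boundaryTrace P₁ zb za) =
      Sum.elim u.ofLp v.ofLp := by
    rw [← Matrix.fromRows_mulVec, h, Matrix.mulVec_mulVec, h1, Matrix.one_mulVec]
  refine ⟨zb, za, ?_, ?_⟩
  · rw [boundaryVec_eq, show W_B *ᵥ boundaryTrace P₁ zb za = u.ofLp from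
      funext fun i => congrFun h2 (Sum.inl i)]
  · rw [boundaryVec_eq, show W_C *ᵥ boundaryTrace P₁ zb za = v.ofLp from
      funext fun i => congrFun h2 (Sum.inr i)]

/-- The hypothesis gives `(J W J) W* = 1`. For square matrices a one-sided inverse is two-sided, so
`W* (J W J) = 1`, and multiplying by `J` on the right finishes. -/
theorem conjTranspose_fromRows_mul : (Matrix.fromRows W_B W_C)ᴴ * Matrix.fromBlocks 0 1 1 0 *
    Matrix.fromRows W_B W_C = Matrix.fromBlocks 0 1 1 0 := by
  have h1 : (Matrix.fromBlocks 0 1 1 0 * Matrix.fromRows W_B W_C * Matrix.fromBlocks 0 1 1 0) *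
      (Matrix.fromRows W_B W_C)ᴴ = 1 := by
    rw [Matrix.mul_assoc, Matrix.mul_assoc, ← Matrix.mul_assoc (Matrix.fromRows W_B W_C), ← hW,
      fromBlocks_swap_mul_self]
  have h2 := mul_eq_one_comm.1 h1
  calc _ = (Matrix.fromRows W_B W_C)ᴴ * (Matrix.fromBlocks 0 1 1 0 * Matrix.fromRows W_B W_C *
        Matrix.fromBlocks 0 1 1 0) * Matrix.fromBlocks 0 1 1 0 := by
        simp only [Matrix.mul_assoc, fromBlocks_swap_mul_self, Matrix.mul_one]
    _ = _ := by rw [h2, Matrix.one_mul]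

/-- For traces `e_w`, `e_z`, the form `e_w* J e_z` equals `(wb - wa)* P₁ (zb + za) + (wb + wa)* P₁
(zb - za)` since `P₁` is Hermitian; the mixed terms cancel and twice the boundary term remains.
Replacing `J` by `W* J W` expresses the same form through `W_B` and `W_C`. -/
theorem inner_boundaryVec {P₁ : Matrix (Fin m) (Fin m) ℂ} (hP₁ : P₁.IsHermitian)
    (wb wa zb za : Cm m) :
    ⟪wb, act P₁ zb⟫_ℂ - ⟪wa, act P₁ za⟫_ℂ =
      (1 / 2 : ℂ) * (⟪boundaryVec P₁ W_B wb wa, boundaryVec P₁ W_C zb za⟫_ℂ +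
        ⟪boundaryVec P₁ W_C wb wa, boundaryVec P₁ W_B zb za⟫_ℂ) := by
  have key : star (boundaryTrace P₁ wb wa) ⬝ᵥ ((Matrix.fromBlocks 0 1 1 0 :
      Matrix (Fin m ⊕ Fin m) (Fin m ⊕ Fin m) ℂ) *ᵥ boundaryTrace P₁ zb za) =
      star (W_B *ᵥ boundaryTrace P₁ wb wa) ⬝ᵥ (W_C *ᵥ boundaryTrace P₁ zb za) +
      star (W_C *ᵥ boundaryTrace P₁ wb wa) ⬝ᵥ (W_B *ᵥ boundaryTrace P₁ zb za) := by
    rw [← conjTranspose_fromRows_mul hW, ← Matrix.mulVec_mulVec, ← Matrix.mulVec_mulVec,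
      Matrix.dotProduct_mulVec, ← Matrix.star_mulVec, Matrix.fromRows_mulVec,
      Matrix.fromRows_mulVec, fromBlocks_swap_mulVec, Sum.elim_comp_inr, Sum.elim_comp_inl,
      Function.star_sumElim, sumElim_dotProduct_sumElim]
  simp only [boundaryVec_eq, act_eq_toLp, EuclideanSpace.inner_eq_star_dotProduct]
  simp only [dotProduct_comm _ (star _)]
  rw [← key, fromBlocks_swap_mulVec, boundaryTrace, boundaryTrace, Sum.elim_comp_inr,
    Sum.elim_comp_inl, Function.star_sumElim, sumElim_dotProduct_sumElim]
  have hs : ∀ x y : Fin m → ℂ, star (P₁ *ᵥ x) ⬝ᵥ y = star x ⬝ᵥ (P₁ *ᵥ y) := fun x y => by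
    rw [Matrix.star_mulVec, ← Matrix.dotProduct_mulVec, hP₁.eq]
  rw [hs]
  simp only [star_add, star_sub, Matrix.mulVec_add, Matrix.mulVec_sub, add_dotProduct,
    sub_dotProduct, dotProduct_add, dotProduct_sub]
  ring

end Unitary

theorem hasL1Deriv_inner_act {P₁ : Matrix (Fin m) (Fin m) ℂ} (hab : a ≤ b)
    (hP₁ : P₁.IsHermitian) {w p ζ g : ℝ → Cm m} (hw : HasL1Deriv a b w p)
    (hζ : HasL1Deriv a b ζ g) :
    HasL1Deriv a b (fun t => ⟪w t, act P₁ (ζ t)⟫_ℂ)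
      (fun t => ⟪w t, act P₁ (g t)⟫_ℂ + ⟪act P₁ (p t), ζ t⟫_ℂ) := by
  have hL := hζ.clm_comp hab
    ((Matrix.toEuclideanCLM (n := Fin m) (𝕜 := ℂ) P₁).restrictScalars ℝ)
  have h := (isBoundedBilinearMap_inner (𝕜 := ℂ) (E := Cm m)).hasL1Deriv hab hw hL
  refine h.congr_right (ae_of_all _ fun ξ => ?_)
  simp only [inner_act_left, hP₁.eq]
  rfl

/-- Green's identity for the port operator. -/
theorem integral_inner_act_add {W_B W_C : Matrix (Fin m) (Fin m ⊕ Fin m) ℂ}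
    (hW : (Matrix.fromBlocks 0 1 1 0 : Matrix (Fin m ⊕ Fin m) (Fin m ⊕ Fin m) ℂ) =
      Matrix.fromRows W_B W_C * Matrix.fromBlocks 0 1 1 0 * (Matrix.fromRows W_B W_C)ᴴ)
    {P₁ : Matrix (Fin m) (Fin m) ℂ} (hab : a ≤ b)
    (hP₁ : P₁.IsHermitian) {w p ζ g : ℝ → Cm m} (hw : HasL1Deriv a b w p)
    (hζ : HasL1Deriv a b ζ g) :
    ∫ ξ, (⟪w ξ, act P₁ (g ξ)⟫_ℂ + ⟪act P₁ (p ξ), ζ ξ⟫_ℂ) ∂(intervalMeasure a b) =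
      (1 / 2 : ℂ) * (⟪boundaryVec P₁ W_B (w b) (w a), boundaryVec P₁ W_C (ζ b) (ζ a)⟫_ℂ +
        ⟪boundaryVec P₁ W_C (w b) (w a), boundaryVec P₁ W_B (ζ b) (ζ a)⟫_ℂ) := by
  rw [← inner_boundaryVec hW hP₁]
  exact (hasL1Deriv_inner_act hab hP₁ hw hζ).setIntegral_eq_sub hab

/-! ### Bounds for matrices acting on `ℂᵐ` -/

theorem norm_le_sum_norm_coord (y : Cm m) : ‖y‖ ≤ ∑ i, ‖y i‖ := by
  conv_lhs => rw [← (EuclideanSpace.basisFun (Fin m) ℂ).sum_repr y]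
  refine (norm_sum_le _ _).trans (Finset.sum_le_sum fun i _ => ?_)
  rw [norm_smul, OrthonormalBasis.norm_eq_one, mul_one, EuclideanSpace.basisFun_repr]

theorem norm_act_le (A : Matrix (Fin m) (Fin m) ℂ) (x : Cm m) :
    ‖act A x‖ ≤ (∑ i, ∑ j, ‖A i j‖) * ‖x‖ := by
  refine (norm_le_sum_norm_coord _).trans ?_
  rw [Finset.sum_mul]
  refine Finset.sum_le_sum fun i _ => ?_
  rw [Finset.sum_mul]
  change ‖∑ j, A i j * x j‖ ≤ _
  refine (norm_sum_le _ _).trans (Finset.sum_le_sum fun j _ => ?_)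
  rw [norm_mul]
  gcongr
  exact PiLp.norm_apply_le x j

theorem exists_norm_act_le {A : ℝ → Matrix (Fin m) (Fin m) ℂ} {μ : Measure ℝ}
    (hA : ∀ i j, MemLp (fun ξ => A ξ i j) ⊤ μ) :
    ∃ K : ℝ, 0 ≤ K ∧ ∀ᵐ ξ ∂μ, ∀ x : Cm m, ‖act (A ξ) x‖ ≤ K * ‖x‖ := by
  have h : ∀ i j, ∃ K : ℝ, 0 ≤ K ∧ ∀ᵐ ξ ∂μ, ‖A ξ i j‖ ≤ K := fun i j =>
    ⟨(eLpNorm (fun ξ => A ξ i j) ⊤ μ).toReal, ENNReal.toReal_nonneg, by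
      have h := ae_le_eLpNormEssSup (f := fun ξ => A ξ i j) (μ := μ)
      rw [← eLpNorm_exponent_top] at h
      filter_upwards [h] with ξ hξ
      rw [← toReal_enorm]
      exact ENNReal.toReal_mono (hA i j).2.ne hξ⟩
  choose K hK0 hK using h
  refine ⟨∑ i, ∑ j, K i j, Finset.sum_nonneg fun i _ => Finset.sum_nonneg fun j _ => hK0 i j, ?_⟩
  have h1 : ∀ᵐ ξ ∂μ, ∀ i j, ‖A ξ i j‖ ≤ K i j := ae_all_iff.2 fun i => ae_all_iff.2 (hK i)
  filter_upwards [h1] with ξ h x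
  refine (norm_act_le _ _).trans ?_
  gcongr with i _ j _
  exact h i j

/-! ### Bounded functions and the energetic space -/

namespace EnergySpace

variable {D : HamiltonianDensity a b m}

/-- `A^{-1/2}` is self-adjoint with square `A⁻¹`. This converts integrability of `H⁻¹` into square
integrability of `H^{-1/2}`. -/
theorem norm_inv_sqrt_act_sq {A : Matrix (Fin m) (Fin m) ℂ} (hA : A.PosDef) (x : Cm m) :
    ‖act (CFC.sqrt A)⁻¹ x‖ ^ 2 = (⟪x, act A⁻¹ x⟫_ℂ).re := by
  have h : ((CFC.sqrt A)⁻¹)ᴴ = (CFC.sqrt A)⁻¹ := by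
    rw [Matrix.conjTranspose_nonsing_inv, sqrt_conjTranspose]
  have h2 : (CFC.sqrt A)⁻¹ * (CFC.sqrt A)⁻¹ = A⁻¹ := by
    rw [← Matrix.mul_inv_rev, CFC.sqrt_mul_sqrt_self A hA.posSemidef.nonneg]
  rw [← h2, act_mul, @norm_sq_eq_re_inner ℂ, inner_act_left, h]
  rfl

/-- The square of the norm is `f* H⁻¹ f`, dominated by `K²` times the sum of the moduli of the
entries of `H⁻¹`, which is integrable. -/
theorem memLp_inv_sqrt_act (D : HamiltonianDensity a b m) {f : ℝ → Cm m}
    (hf : AEStronglyMeasurable f (intervalMeasure a b)) {K : ℝ}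
    (hK : ∀ᵐ ξ ∂(intervalMeasure a b), ‖f ξ‖ ≤ K) :
    MemLp (fun ξ => act (CFC.sqrt (D.toFun ξ))⁻¹ (f ξ)) 2 (intervalMeasure a b) := by
  have hm := aestronglyMeasurable_inv_sqrt_act D hf
  rw [memLp_two_iff_integrable_sq_norm hm]
  have hi : Integrable (fun ξ => (∑ i, ∑ j, ‖(D.toFun ξ)⁻¹ i j‖) * K ^ 2) (intervalMeasure a b) :=
    (integrable_finsetSum _ fun i _ => integrable_finsetSum _ fun j _ =>
      (D.integrable_inv i j).norm).mul_const _
  refine hi.mono' (hm.norm.pow 2) ?_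
  filter_upwards [hK, D.posDef] with ξ h1 hp
  rw [Real.norm_of_nonneg (by positivity), norm_inv_sqrt_act_sq hp]
  refine (Complex.re_le_norm _).trans ((norm_inner_le_norm _ _).trans ?_)
  have h2 := norm_act_le (D.toFun ξ)⁻¹ (f ξ)
  have h0 : 0 ≤ ∑ i, ∑ j, ‖(D.toFun ξ)⁻¹ i j‖ :=
    Finset.sum_nonneg fun i _ => Finset.sum_nonneg fun j _ => norm_nonneg _
  calc ‖f ξ‖ * ‖act (D.toFun ξ)⁻¹ (f ξ)‖
      ≤ ‖f ξ‖ * ((∑ i, ∑ j, ‖(D.toFun ξ)⁻¹ i j‖) * ‖f ξ‖) := by gcongr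
    _ = (∑ i, ∑ j, ‖(D.toFun ξ)⁻¹ i j‖) * ‖f ξ‖ ^ 2 := by ring
    _ ≤ _ := by gcongr

/-- Bounded functions belong to `X_h`. -/
theorem mem_energySubmodule_of_bound (D : HamiltonianDensity a b m) (x : MeasFun a b m) {K : ℝ}
    (hK : ∀ᵐ ξ ∂(intervalMeasure a b), ‖x ξ‖ ≤ K) : x ∈ energySubmodule D := by
  -- Applied to the density `H⁻¹`, this says that `H^{1/2} x ∈ L²`, which is the required preimage
  -- of `x`.
  have h := memLp_inv_sqrt_act D.inv x.aestronglyMeasurable hK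
  refine ⟨h.toLp _, ?_⟩
  filter_upwards [h.coeFn_toLp, D.posDef] with ξ h1 hp
  rw [h1]
  change _ = act _ (act (CFC.sqrt (D.toFun ξ)⁻¹)⁻¹ _)
  rw [sqrt_inv_inv hp, sqrt_inv_act hp]

/-- The elements of `X_h` are integrable. -/
theorem integrable_val (x : EnergySpace D) : Integrable x.val (intervalMeasure a b) := by
  -- The `i`-th coordinate of `x = H^{-1/2} f` is `⟪H^{-1/2} eᵢ, f⟫`, a pairing of two square
  -- integrable functions.
  have h : ∀ i : Fin m, Integrable (fun ξ => ⟪act (CFC.sqrt (D.toFun ξ))⁻¹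
      (EuclideanSpace.basisFun (Fin m) ℂ i), x.toL2Fun ξ⟫_ℂ) (intervalMeasure a b) := fun i =>
    have hi := memLp_inv_sqrt_act D (aestronglyMeasurable_const
      (b := EuclideanSpace.basisFun (Fin m) ℂ i)) (ae_of_all _ fun _ => le_rfl)
    (L2.integrable_inner (𝕜 := ℂ) (hi.toLp _) x.toL2Fun).congr
      (hi.coeFn_toLp.mono fun ξ h => by simp only [h])
  refine (integrable_finsetSum Finset.univ fun i _ => (h i).norm).mono'
    x.val.aestronglyMeasurable ?_
  filter_upwards [x.toL2Fun_spec] with ξ h1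
  refine (norm_le_sum_norm_coord _).trans (Finset.sum_le_sum fun i _ => le_of_eq ?_)
  have h2 : ((CFC.sqrt (D.toFun ξ))⁻¹)ᴴ = (CFC.sqrt (D.toFun ξ))⁻¹ := by
    rw [Matrix.conjTranspose_nonsing_inv, sqrt_conjTranspose]
  rw [inner_act_left, h2, ← h1, EuclideanSpace.basisFun_apply, EuclideanSpace.inner_single_left,
    map_one, one_mul]

theorem coe_sub (x y : EnergySpace D) :
    ∀ᵐ ξ ∂(intervalMeasure a b), (x - y).val ξ = x.val ξ - y.val ξ :=
  AEEqFun.coeFn_sub x.val y.val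

/-- `⟨x, z⟩_{X_h} = ∫ (H x)* z`. -/
theorem inner_eq_integral_riesz (x z : EnergySpace D) : ⟪x, z⟫_ℂ =
    ∫ ξ, ⟪(riesz D x).val ξ, z.val ξ⟫_ℂ ∂(intervalMeasure a b) := by
  rw [inner_def]
  refine integral_congr_ae ?_
  filter_upwards [riesz_val D x, D.posDef] with ξ h hp
  rw [h, inner_act_left, hp.isHermitian.eq]

theorem riesz_symm_val (x : DualEnergySpace D) :
    ∀ᵐ ξ ∂(intervalMeasure a b), x.val ξ = act (D.toFun ξ) (((riesz D).symm x).val ξ) := by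
  have := riesz_val D ((riesz D).symm x)
  rwa [LinearIsometryEquiv.apply_symm_apply] at this

/-- `∫ (H x)* (H⁻¹ z) = ∫ x* z`. -/
theorem inner_riesz_riesz_symm (x : EnergySpace D) (z : DualEnergySpace D) :
    ∀ᵐ ξ ∂(intervalMeasure a b), ⟪(riesz D x).val ξ, ((riesz D).symm z).val ξ⟫_ℂ =
      ⟪x.val ξ, z.val ξ⟫_ℂ := by
  filter_upwards [riesz_val D x, riesz_symm_val z, D.posDef] with ξ h1 h2 hp
  rw [h1, h2, inner_act_left, hp.isHermitian.eq]

theorem pairing_eq_inner (x' : DualEnergySpace D) (x : EnergySpace D) :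
    (energyAntiDual D).pairing x' x = ⟪x, (riesz D).symm x'⟫_ℂ := by
  rw [← (energyAntiDual D).pairing_riesz]
  exact congrArg (fun y => (energyAntiDual D).pairing y x) ((riesz D).apply_symm_apply x').symm

theorem eq_zero_of_ae {x : EnergySpace D} (h : ∀ᵐ ξ ∂(intervalMeasure a b), x.val ξ = 0) :
    x = 0 := by
  apply val_injective
  apply AEEqFun.ext
  filter_upwards [h, AEEqFun.coeFn_zero (μ := intervalMeasure a b) (β := Cm m)] with ξ h1 h2
  rw [h1]; exact h2.symm

end EnergySpace

/-- A subspace is dense if nothing but `0` is orthogonal to it. -/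
theorem _root_.Submodule.dense_of_forall_inner_eq_zero {E : Type*} [NormedAddCommGroup E]
    [InnerProductSpace ℂ E] [CompleteSpace E] (K : Submodule ℂ E)
    (h : ∀ x : E, (∀ y ∈ K, ⟪x, y⟫_ℂ = 0) → x = 0) : Dense (K : Set E) := by
  rw [Submodule.dense_iff_topologicalClosure_eq_top, Submodule.topologicalClosure_eq_top_iff,
    Submodule.eq_bot_iff]
  exact fun x hx => h x fun y hy => (Submodule.mem_orthogonal' K x).1 hx y hy

/-! ### Abstract dissipative operators and closures -/

section Abstract

/-- Dissipativity passes to the closure of the graph. If `(0, y)` lies there, any multiple of it may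
be added to `(w, T w)` without destroying dissipativity, which forces `⟪y, J w⟫ = 0` for all `w` in
the dense domain; as `J` is onto, `y = 0`. -/
theorem _root_.LinearPMap.isClosable_of_dissipative {E E' : Type*} [NormedAddCommGroup E]
    [InnerProductSpace ℂ E] [NormedAddCommGroup E'] [InnerProductSpace ℂ E'] (J : E' ≃ₗᵢ[ℂ] E)
    (T : E' →ₗ.[ℂ] E) (hT : Dense (T.domain : Set E'))
    (hd : ∀ p ∈ T.graph, (⟪p.2, J p.1⟫_ℂ).re ≤ 0) : T.IsClosable := by
  have hcl : ∀ p ∈ T.graph.topologicalClosure, (⟪p.2, J p.1⟫_ℂ).re ≤ 0 := fun p hp =>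
    closure_minimal (t := {p : E' × E | (⟪p.2, J p.1⟫_ℂ).re ≤ 0}) hd
      (isClosed_le (by fun_prop) continuous_const) hp
  refine ⟨T.graph.topologicalClosure.toLinearPMap, (Submodule.toLinearPMap_graph_eq _ ?_).symm⟩
  rintro ⟨x, y⟩ hxy hx
  change x = 0 at hx
  subst hx
  change y = 0
  have key : ∀ w ∈ T.domain, ⟪y, J w⟫_ℂ = 0 := by
    intro w hw
    have hg : (w, T ⟨w, hw⟩) ∈ T.graph.topologicalClosure :=
      T.graph.le_topologicalClosure (T.mem_graph ⟨w, hw⟩)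
    by_contra hne
    set s := ⟪y, J w⟫_ℂ with hs
    set r := (⟪T ⟨w, hw⟩, J w⟫_ℂ).re with hr
    have hpos : 0 < ‖s‖ ^ 2 := by positivity
    -- The scalar is chosen so that its contribution to the real part is `1 - r`; the total is then
    -- `1`, contradicting dissipativity.
    have h1 := hcl _ (T.graph.topologicalClosure.add_mem
      (T.graph.topologicalClosure.smul_mem ((((1 - r) / ‖s‖ ^ 2 : ℝ) : ℂ) * s) hxy) hg)
    have h2 : ⟪((((1 - r) / ‖s‖ ^ 2 : ℝ) : ℂ) * s) • y + T ⟨w, hw⟩, J w⟫_ℂ =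
        ((((1 - r) / ‖s‖ ^ 2 * ‖s‖ ^ 2 : ℝ)) : ℂ) + ⟪T ⟨w, hw⟩, J w⟫_ℂ := by
      rw [inner_add_left, inner_smul_left, ← hs, map_mul, Complex.conj_ofReal, mul_assoc,
        Complex.conj_mul']
      push_cast
      ring
    have h3 : (((((1 - r) / ‖s‖ ^ 2 : ℝ) : ℂ) * s) • ((0 : E'), y) + (w, T ⟨w, hw⟩)) =
        (w, ((((1 - r) / ‖s‖ ^ 2 : ℝ) : ℂ) * s) • y + T ⟨w, hw⟩) := by
      ext <;> simp
    rw [h3] at h1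
    simp only at h1
    rw [h2, Complex.add_re, Complex.ofReal_re, ← hr, div_mul_cancel₀ _ hpos.ne'] at h1
    linarith
  have h4 : ∀ w : E', ⟪y, J w⟫_ℂ = 0 := fun w =>
    (isClosed_eq (f := fun w => ⟪y, J w⟫_ℂ) (by fun_prop) continuous_const).closure_subset_iff.2
      key (hT w)
  have h5 := h4 (J.symm y)
  rwa [J.apply_symm_apply, inner_self_eq_zero] at h5

variable {X X' U : Type*} [NormedAddCommGroup X] [InnerProductSpace ℂ X]
  [NormedAddCommGroup X'] [InnerProductSpace ℂ X'] [NormedAddCommGroup U] [InnerProductSpace ℂ U]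

theorem AntiDual.pairing_eq (P : AntiDual X X') (x' : X') (x : X) :
    P.pairing x' x = ⟪x, P.riesz.symm x'⟫_ℂ := by
  rw [← P.pairing_riesz, LinearIsometryEquiv.apply_symm_apply]

/-- `R⁻¹ × I`, an isometric isomorphism `X' × U → X × U`. -/
def AntiDual.prodIso (P : AntiDual X X') (U : Type*) [NormedAddCommGroup U]
    [InnerProductSpace ℂ U] : WithLp 2 (X' × U) ≃ₗᵢ[ℂ] WithLp 2 (X × U) where
  toLinearEquiv := (WithLp.linearEquiv 2 ℂ (X' × U)).trans
    ((P.riesz.symm.toLinearEquiv.prodCongr (LinearEquiv.refl ℂ U)).trans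
      (WithLp.linearEquiv 2 ℂ (X × U)).symm)
  norm_map' w := by
    rw [WithLp.prod_norm_eq_of_L2, WithLp.prod_norm_eq_of_L2]
    change √(‖P.riesz.symm w.fst‖ ^ 2 + ‖w.snd‖ ^ 2) = _
    rw [LinearIsometryEquiv.norm_map]

/-- The supply rate of a node is an inner product twisted by the unitary map `R⁻¹ × I`, which places
node dissipativity within the scope of ordinary dissipative operators. -/
theorem AntiDual.inner_prodIso (P : AntiDual X X') (q : WithLp 2 (X × U))
    (w : WithLp 2 (X' × U)) :
    ⟪q, P.prodIso U w⟫_ℂ = P.pairing w.fst q.fst + ⟪q.snd, w.snd⟫_ℂ := by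
  rw [WithLp.prod_inner_apply, P.pairing_eq]
  rfl

theorem norm_sub_add_smul_le {E : Type*} [NormedAddCommGroup E] [NormedSpace ℂ E] {x y z : E}
    {N C n ε : ℝ} (hε : 0 ≤ ε) (hx : ‖x‖ ≤ N) (hy : ‖y‖ ≤ C * N) (hz : ‖z‖ ≤ C * n) :
    ‖x - y + (ε : ℂ) • z‖ ≤ (1 + C) * N + ε * C * n := by
  refine (norm_add_le _ _).trans (add_le_add ((norm_sub_le _ _).trans ?_) ?_)
  · linarith
  · rw [norm_smul, Complex.norm_of_nonneg hε, mul_assoc]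
    gcongr

/-- The left side is linear in `ε`, while the terms in `n²` on the right are quadratic once `(K + ε
C n)² ≤ 2 K² + 2 ε² C² n²` is used. At `ε = 1 / (2 A)` they are absorbed, leaving `(A + 1) n² ≤ 8 A²
K²`; with `A ≥ 1` this gives the claim. -/
theorem norm_sq_le_of_scaled {C K n : ℝ} (hC : 0 ≤ C) (hK : 0 ≤ K)
    (h : ∀ ε : ℝ, 0 < ε → ε * n ^ 2 ≤ (K + ε * C * n) ^ 2 + ε ^ 2 * C * n ^ 2) :
    n ≤ 2 * (2 * C ^ 2 + C + 1) * K := by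
  set A := 2 * C ^ 2 + C + 1 with hA
  have hA0 : 1 ≤ A := by nlinarith
  by_contra! hlt
  have hn0 : 0 < n := lt_of_le_of_lt (by positivity) hlt
  have h1 := h (1 / (2 * A)) (by positivity)
  have h2 : (K + 1 / (2 * A) * C * n) ^ 2 ≤ 2 * K ^ 2 + 2 * (1 / (2 * A) * C * n) ^ 2 := by
    nlinarith [sq_nonneg (K - 1 / (2 * A) * C * n)]
  have h3 : 1 / (2 * A) * n ^ 2 - (2 * (1 / (2 * A) * C * n) ^ 2 +
      (1 / (2 * A)) ^ 2 * C * n ^ 2) = (A + 1) * n ^ 2 / (4 * A ^ 2) := by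
    field_simp
    rw [hA]; ring
  have h4 : (A + 1) * n ^ 2 / (4 * A ^ 2) ≤ 2 * K ^ 2 := by linarith
  rw [div_le_iff₀ (by positivity)] at h4
  have h5 : (2 * A * K) ^ 2 < n ^ 2 := by gcongr
  nlinarith [sq_nonneg K]

/-- Convergence of states, inputs and first-row values must force convergence of outputs.
Dissipativity supplies the estimate: using a multiple of the output as an additional input makes the
output visible in the supply rate. Hence forgetting the output is bounded below on the complete
graph of `S`, and its range, the graph of the first row, is closed. -/
theorem isClosed_firstRow_of_dissipative [CompleteSpace X] [CompleteSpace X']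
    [FiniteDimensional ℂ U] (P : AntiDual X X') (S : NodeOp X' X U) (hS : S.IsClosed)
    (hd : ∀ p ∈ S.graph, (⟪p.2, P.prodIso U p.1⟫_ℂ).re ≤ 0)
    (hU : ∀ u : U, ∃ x' : X', WithLp.toLp 2 (x', u) ∈ S.domain) : (firstRow S).IsClosed := by
  have : CompleteSpace U := FiniteDimensional.complete ℂ U
  have : CompleteSpace S.graph := IsClosed.completeSpace_coe (hs := hS)
  -- a bounded linear selection of the inputs
  let L : S.graph →ₗ[ℂ] U :=
    (WithLp.sndₗ 2 ℂ X' U) ∘ₗ (LinearMap.fst ℂ _ _) ∘ₗ S.graph.subtype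
  have hL : Function.Surjective L := fun u => by
    obtain ⟨x', hx'⟩ := hU u
    exact ⟨⟨(WithLp.toLp 2 (x', u), S ⟨_, hx'⟩), S.mem_graph ⟨_, hx'⟩⟩, rfl⟩
  obtain ⟨r, hr⟩ := L.exists_rightInverse_of_surjective (LinearMap.range_eq_top.2 hL)
  have hru : ∀ u, (r u).1.1.snd = u := fun u => LinearMap.congr_fun hr u
  let rc : U →L[ℂ] S.graph := LinearMap.toContinuousLinearMap r
  set C := ‖rc‖ with hC
  have hrC : ∀ u, ‖(r u).1‖ ≤ C * ‖u‖ := fun u => rc.le_opNorm u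
  have hfst' : ∀ p : WithLp 2 (X' × U) × WithLp 2 (X × U), ‖p.1.fst‖ ≤ ‖p‖ := fun p =>
    (WithLp.norm_fst_le X' p.1).trans (norm_fst_le p)
  have hfst : ∀ p : WithLp 2 (X' × U) × WithLp 2 (X × U), ‖p.2.fst‖ ≤ ‖p‖ := fun p =>
    (WithLp.norm_fst_le X p.2).trans (norm_snd_le p)
  have hsnd : ∀ p : WithLp 2 (X' × U) × WithLp 2 (X × U), ‖p.2.snd‖ ≤ ‖p‖ := fun p =>
    (WithLp.norm_snd_le X p.2).trans (norm_snd_le p)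
  -- outputs are controlled by states and inputs
  have bound : ∀ p ∈ S.graph, ∀ N : ℝ, ‖p.1‖ ≤ N → ‖p.2.fst‖ ≤ N →
      ‖p.2.snd‖ ≤ (2 * (2 * C ^ 2 + C + 1) * (1 + C) + C) * N := by
    intro p hp N h1 h2
    have hC0 : 0 ≤ C := norm_nonneg rc
    have hN : 0 ≤ N := (norm_nonneg _).trans h1
    set u := p.1.snd with hu
    have huN : ‖(r u).1‖ ≤ C * N := (hrC u).trans (by
      gcongr; exact (WithLp.norm_snd_le X' p.1).trans h1)
    set v := p.2.snd - (r u).1.2.snd with hv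
    have h3 : ‖v‖ ≤ 2 * (2 * C ^ 2 + C + 1) * ((1 + C) * N) := by
      refine norm_sq_le_of_scaled hC0 (by positivity) fun ε hε => ?_
      -- Subtracting `r u` removes the input and leaves output `v`; adding `ε • r v` creates the
      -- input `ε v`. The supply term is then `ε ‖v‖²` up to an error of size `ε² C ‖v‖²`, while the
      -- state term is at most `((1 + C) N + ε C ‖v‖)²`.
      have hq := hd _ (S.graph.add_mem (S.graph.sub_mem hp (r u).2)
        (S.graph.smul_mem (ε : ℂ) (r v).2))
      have e1 : (p - (r u).1 + (ε : ℂ) • (r v).1).1.snd = (ε : ℂ) • v := by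
        change p.1.snd - (r u).1.1.snd + (ε : ℂ) • (r v).1.1.snd = _
        rw [hru, hru, hu, sub_self, zero_add]
      have e2 : (p - (r u).1 + (ε : ℂ) • (r v).1).2.snd = v + (ε : ℂ) • (r v).1.2.snd := rfl
      have e3 : ‖(p - (r u).1 + (ε : ℂ) • (r v).1).1.fst‖ ≤ (1 + C) * N + ε * C * ‖v‖ :=
        norm_sub_add_smul_le hε.le ((WithLp.norm_fst_le X' p.1).trans h1) ((hfst' _).trans huN) ((hfst' _).trans (hrC v))
      have e4 : ‖(p - (r u).1 + (ε : ℂ) • (r v).1).2.fst‖ ≤ (1 + C) * N + ε * C * ‖v‖ :=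
        norm_sub_add_smul_le hε.le h2 ((hfst _).trans huN) ((hfst _).trans (hrC v))
      rw [P.inner_prodIso, e1, e2, P.pairing_eq, inner_add_left, inner_smul_right,
        inner_smul_right, inner_smul_left, inner_self_eq_norm_sq_to_K] at hq
      set q := p - (r u).1 + (ε : ℂ) • (r v).1 with hqdef
      have e5 : ‖⟪q.2.fst, P.riesz.symm q.1.fst⟫_ℂ‖ ≤ ((1 + C) * N + ε * C * ‖v‖) ^ 2 := by
        refine (norm_inner_le_norm _ _).trans ?_
        rw [LinearIsometryEquiv.norm_map, sq]
        gcongr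
      have e6 : ‖(ε : ℂ) * ((starRingEnd ℂ) (ε : ℂ) * ⟪(r v).1.2.snd, v⟫_ℂ)‖ ≤
          ε ^ 2 * C * ‖v‖ ^ 2 := by
        rw [norm_mul, norm_mul, RCLike.norm_conj, Complex.norm_of_nonneg hε.le]
        calc ε * (ε * ‖⟪(r v).1.2.snd, v⟫_ℂ‖) ≤ ε * (ε * (C * ‖v‖ * ‖v‖)) := by
              gcongr
              refine (norm_inner_le_norm _ _).trans ?_
              gcongr
              exact (hsnd _).trans (hrC v)
          _ = _ := by ring
      have e7 : ((ε : ℂ) * ((‖v‖ : ℝ) : ℂ) ^ 2).re = ε * ‖v‖ ^ 2 := by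
        rw [← Complex.ofReal_pow, ← Complex.ofReal_mul, Complex.ofReal_re]
      have e8 := (abs_le.1 ((Complex.abs_re_le_norm _).trans e5)).1
      have e9 := (abs_le.1 ((Complex.abs_re_le_norm _).trans e6)).1
      rw [Complex.add_re, Complex.add_re] at hq
      change _ + (((ε : ℂ) * ((‖v‖ : ℝ) : ℂ) ^ 2).re + _) ≤ 0 at hq
      rw [e7] at hq
      linarith
    calc ‖p.2.snd‖ = ‖v + (r u).1.2.snd‖ := by rw [hv, sub_add_cancel]
      _ ≤ 2 * (2 * C ^ 2 + C + 1) * ((1 + C) * N) + C * N :=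
        (norm_add_le _ _).trans (add_le_add h3 ((hsnd _).trans huN))
      _ = _ := by ring
  let T : S.graph →L[ℂ] WithLp 2 (X' × U) × X :=
    ((ContinuousLinearMap.id ℂ _).prodMap (WithLp.fstL 2 ℂ X U)).comp S.graph.subtypeL
  have hC0 : 0 ≤ C := norm_nonneg rc
  let A : NNReal := ⟨1 + (2 * (2 * C ^ 2 + C + 1) * (1 + C) + C), by positivity⟩
  have hanti : AntilipschitzWith A T := by
    refine T.antilipschitz_of_bound fun p => ?_
    have h1 : ‖p.1.1‖ ≤ ‖T p‖ := norm_fst_le (T p)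
    have h2 : ‖p.1.2.fst‖ ≤ ‖T p‖ := norm_snd_le (T p)
    have h3 := bound p.1 p.2 _ h1 h2
    change ‖p.1‖ ≤ (1 + (2 * (2 * C ^ 2 + C + 1) * (1 + C) + C)) * ‖T p‖
    have h0 : 0 ≤ (2 * (2 * C ^ 2 + C + 1) * (1 + C) + C) * ‖T p‖ := by positivity
    refine max_le (h1.trans (by linarith)) ?_
    rw [WithLp.prod_norm_eq_of_L2]
    refine Real.sqrt_le_iff.2 ⟨by linarith [norm_nonneg (T p)], ?_⟩
    nlinarith [norm_nonneg (T p), norm_nonneg p.1.2.fst, norm_nonneg p.1.2.snd]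
  have hr := hanti.isClosed_range T.uniformContinuous
  have he : ((firstRow S).graph : Set (WithLp 2 (X' × U) × X)) = range T := by
    ext ⟨w, x⟩
    rw [SetLike.mem_coe, LinearPMap.mem_graph_iff]
    constructor
    · rintro ⟨y, rfl, rfl⟩
      exact ⟨⟨(y, S y), S.mem_graph y⟩, rfl⟩
    · rintro ⟨⟨p, hp⟩, h⟩
      obtain ⟨y, h1, h2⟩ := (LinearPMap.mem_graph_iff S).1 hp
      refine ⟨y, h1.trans (congrArg Prod.fst h), ?_⟩
      refine Eq.trans ?_ (congrArg Prod.snd h)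
      change (S y).fst = p.2.fst
      rw [h2]
  rw [LinearPMap.IsClosed, he]
  exact hr

/-- The closure of a densely defined dissipative operator with sufficiently many inputs and with
the range condition is a dissipation node. -/
theorem isDissipationNode_closure [CompleteSpace X] [CompleteSpace X']
    [FiniteDimensional ℂ U] (P : AntiDual X X') (S : NodeOp X' X U)
    (hdense : Dense (S.domain : Set (WithLp 2 (X' × U))))
    (hd : ∀ p ∈ S.graph, (⟪p.2, P.prodIso U p.1⟫_ℂ).re ≤ 0)
    (hU : ∀ u : U, ∃ x' : X', WithLp.toLp 2 (x', u) ∈ S.domain)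
    (hr : Dense {y : X | ∃ (x' : X') (q : WithLp 2 (X × U)),
      (WithLp.toLp 2 (x', 0), q) ∈ S.graph ∧ y = q.fst - P.riesz.symm x'}) :
    S.IsClosable ∧ IsDissipationNode P S.closure := by
  have hc := LinearPMap.isClosable_of_dissipative (P.prodIso U) S hdense hd
  have hle := S.le_closure
  have hcd : ∀ p ∈ S.closure.graph, (⟪p.2, P.prodIso U p.1⟫_ℂ).re ≤ 0 := fun p hp => by
    rw [← hc.graph_closure_eq_closure_graph] at hp
    exact closure_minimal (s := (S.graph : Set (WithLp 2 (X' × U) × WithLp 2 (X × U))))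
      (t := {p : WithLp 2 (X' × U) × WithLp 2 (X × U) | (⟪p.2, P.prodIso U p.1⟫_ℂ).re ≤ 0}) hd
      (isClosed_le (by fun_prop) continuous_const) hp
  have hcU : ∀ u : U, ∃ x' : X', WithLp.toLp 2 (x', u) ∈ S.closure.domain := fun u =>
    (hU u).imp fun _ h => hle.1 h
  -- The range condition is verified with `λ = 1`.
  refine ⟨hc, hc.closure_isClosed, fun w => ?_,
    isClosed_firstRow_of_dissipative P _ hc.closure_isClosed hcd hcU, hcU, 1, by simp, ?_⟩
  · rw [← P.inner_prodIso]
    exact hcd _ (S.closure.mem_graph w)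
  · have hneg : DenseRange fun y : X => -y := neg_surjective.denseRange
    refine (hneg.dense_image continuous_neg hr).mono ?_
    rintro _ ⟨_, ⟨x', q, hq, rfl⟩, rfl⟩
    obtain ⟨y, h1, h2⟩ := (LinearPMap.mem_graph_iff _).1 (LinearPMap.le_graph_of_le hle hq)
    have h1' : (y : WithLp 2 (X' × U)) = WithLp.toLp 2 (x', 0) := h1
    have hmem : WithLp.toLp 2 (x', 0) ∈ S.closure.domain := h1' ▸ y.2
    have h3 : S.closure ⟨_, hmem⟩ = q := by
      refine Eq.trans ?_ h2
      congr 1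
      exact Subtype.ext h1'.symm
    refine ⟨⟨x', hmem⟩, ?_⟩
    change (1 : ℂ) • P.riesz.symm x' - (S.closure ⟨_, hmem⟩).fst = _
    rw [h3, one_smul]
    exact (neg_sub _ _).symm

end Abstract

/-! ### Continuously differentiable functions and the graph of the port operator -/

theorem inner_act_right (A : Matrix (Fin m) (Fin m) ℂ) (x y : Cm m) :
    ⟪x, act A y⟫_ℂ = ⟪act Aᴴ x, y⟫_ℂ := by
  rw [inner_act_left, Matrix.conjTranspose_conjTranspose]

theorem inv_sqrt_two_mul_self : ((1 / √2 : ℝ) : ℂ) * ((1 / √2 : ℝ) : ℂ) = 1 / 2 := by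
  rw [← Complex.ofReal_mul, div_mul_div_comm, Real.mul_self_sqrt (by norm_num)]
  push_cast
  norm_num

theorem IsC1Rep.add {x y : MeasFun a b m} {ζ η : ℝ → Cm m} (hx : IsC1Rep x ζ)
    (hy : IsC1Rep y η) : IsC1Rep (x + y) (ζ + η) where
  contDiffOn := hx.contDiffOn.add hy.contDiffOn
  ae_eq := by
    filter_upwards [hx.ae_eq, hy.ae_eq, AEEqFun.coeFn_add x y] with ξ h1 h2 h3
    rw [h3, Pi.add_apply, Pi.add_apply, h1, h2]

theorem IsC1Rep.smul {x : MeasFun a b m} {ζ : ℝ → Cm m} (hx : IsC1Rep x ζ) (c : ℂ) :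
    IsC1Rep (c • x) (c • ζ) where
  contDiffOn := hx.contDiffOn.const_smul c
  ae_eq := by
    filter_upwards [hx.ae_eq, AEEqFun.coeFn_smul c x] with ξ h1 h3
    rw [h3, Pi.smul_apply, Pi.smul_apply, h1]

theorem isC1Rep_zero : IsC1Rep (0 : MeasFun a b m) 0 where
  contDiffOn := contDiffOn_const
  ae_eq := AEEqFun.coeFn_zero

theorem IsC1Rep.exists_norm_le {x : MeasFun a b m} {ζ : ℝ → Cm m} (hx : IsC1Rep x ζ) :
    ∃ K : ℝ, ∀ᵐ ξ ∂(intervalMeasure a b), ‖x ξ‖ ≤ K := by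
  obtain ⟨K, hK⟩ := isCompact_Icc.exists_bound_of_continuousOn hx.contDiffOn.continuousOn
  refine ⟨K, ?_⟩
  filter_upwards [hx.ae_eq, ae_restrict_mem measurableSet_Icc] with ξ h1 h2
  rw [h1]
  exact hK ξ h2

theorem exists_L2_act_add {A : ℝ → Matrix (Fin m) (Fin m) ℂ}
    (hA : ∀ i j, MemLp (fun ξ => A ξ i j) ⊤ (intervalMeasure a b))
    (B : Matrix (Fin m) (Fin m) ℂ) {ζ η : ℝ → Cm m} (hζ : ContinuousOn ζ (Icc a b))
    (hη : ContinuousOn η (Icc a b)) :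
    ∃ f : L2 a b m, (∀ᵐ ξ ∂(intervalMeasure a b), f ξ = act (A ξ) (ζ ξ) + act B (η ξ)) ∧
      ∃ K : ℝ, ∀ᵐ ξ ∂(intervalMeasure a b), ‖f ξ‖ ≤ K := by
  obtain ⟨K, hK0, hK⟩ := exists_norm_act_le hA
  obtain ⟨C, hC⟩ := isCompact_Icc.exists_bound_of_continuousOn hζ
  obtain ⟨E, hE⟩ := isCompact_Icc.exists_bound_of_continuousOn hη
  have hm : AEStronglyMeasurable (fun ξ => act (A ξ) (ζ ξ) + act B (η ξ)) (intervalMeasure a b) :=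
    (aestronglyMeasurable_act (fun i j => (hA i j).1)
      (hζ.aestronglyMeasurable measurableSet_Icc)).add
      (aestronglyMeasurable_act (fun i j => aestronglyMeasurable_const)
        (hη.aestronglyMeasurable measurableSet_Icc))
  have hb : ∀ᵐ ξ ∂(intervalMeasure a b), ‖act (A ξ) (ζ ξ) + act B (η ξ)‖ ≤
      K * C + ‖Matrix.toEuclideanCLM (n := Fin m) (𝕜 := ℂ) B‖ * E := by
    filter_upwards [hK, ae_restrict_mem measurableSet_Icc] with ξ h1 h2
    refine (norm_add_le _ _).trans (add_le_add ((h1 _).trans ?_)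
      ((ContinuousLinearMap.le_opNorm _ _).trans ?_))
    · gcongr
      exact hC ξ h2
    · gcongr
      exact hE ξ h2
  have hL := MemLp.of_bound (p := 2) hm _ hb
  refine ⟨hL.toLp _, hL.coeFn_toLp, K * C + ‖Matrix.toEuclideanCLM (n := Fin m) (𝕜 := ℂ) B‖ * E, ?_⟩
  filter_upwards [hb, hL.coeFn_toLp] with ξ h1 h2
  rw [h2]
  exact h1

theorem exists_L2_eq_of_continuousOn {ζ : ℝ → Cm m} (hζ : ContinuousOn ζ (Icc a b)) :
    ∃ f : L2 a b m, ∀ᵐ ξ ∂(intervalMeasure a b), f ξ = ζ ξ := by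
  obtain ⟨C, hC⟩ := isCompact_Icc.exists_bound_of_continuousOn hζ
  have hL := MemLp.of_bound (p := 2) (μ := intervalMeasure a b)
    (hζ.aestronglyMeasurable measurableSet_Icc) C
    ((ae_restrict_mem measurableSet_Icc).mono fun ξ h => hC ξ h)
  exact ⟨hL.toLp _, hL.coeFn_toLp⟩

/-- `C¹` functions belong to the domain of the port operator, which maps them to bounded
functions. -/
theorem exists_mem_portGraph (hab : a < b) {P₀ : ℝ → Matrix (Fin m) (Fin m) ℂ}
    (hP₀ : ∀ i j, MemLp (fun ξ => P₀ ξ i j) ⊤ (intervalMeasure a b))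
    (P₁ : Matrix (Fin m) (Fin m) ℂ) (W_B W_C : Matrix (Fin m) (Fin m ⊕ Fin m) ℂ)
    {ζ : ℝ → Cm m} (hζ : ContDiffOn ℝ 1 ζ (Icc a b)) :
    ∃ z f : L2 a b m, (∀ᵐ ξ ∂(intervalMeasure a b), z ξ = ζ ξ) ∧
      (∀ᵐ ξ ∂(intervalMeasure a b),
        f ξ = act (P₀ ξ) (ζ ξ) + act P₁ (derivWithin ζ (Icc a b) ξ)) ∧
      (∃ K : ℝ, ∀ᵐ ξ ∂(intervalMeasure a b), ‖f ξ‖ ≤ K) ∧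
      ((WithLp.toLp 2 (z, ((1 / √2 : ℝ) : ℂ) • boundaryVec P₁ W_B (ζ b) (ζ a)),
        WithLp.toLp 2 (f, -(((1 / √2 : ℝ) : ℂ) • boundaryVec P₁ W_C (ζ b) (ζ a)))) :
        WithLp 2 (L2 a b m × Cm m) × WithLp 2 (L2 a b m × Cm m)) ∈
        portGraph a b P₀ P₁ W_B W_C := by
  have hc : ContinuousOn (derivWithin ζ (Icc a b)) (Icc a b) :=
    hζ.continuousOn_derivWithin (uniqueDiffOn_Icc hab) le_rfl
  obtain ⟨z, hz⟩ := exists_L2_eq_of_continuousOn hζ.continuousOn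
  obtain ⟨g, hg⟩ := exists_L2_eq_of_continuousOn hc
  obtain ⟨f, hf, hfK⟩ := exists_L2_act_add hP₀ P₁ hζ.continuousOn hc
  refine ⟨z, f, hz, hf, hfK, g, ζ, (hζ.hasL1Deriv hab.le).isSobolev hab.le hz hg, rfl, ?_, rfl⟩
  filter_upwards [hz, hg, hf] with ξ h1 h2 h3
  change f ξ = act (P₀ ξ) (z ξ) + act P₁ (g ξ)
  rw [h1, h2, h3]

/-- An affine function with prescribed values at `a` and `b`. -/
theorem exists_contDiff_boundary (hab : a < b) (zb za : Cm m) :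
    ∃ ζ : ℝ → Cm m, ContDiff ℝ 1 ζ ∧ ζ b = zb ∧ ζ a = za := by
  refine ⟨fun t => za + ((t - a) / (b - a)) • (zb - za), by fun_prop, ?_, by simp⟩
  simp only
  rw [div_self (sub_ne_zero.2 hab.ne'), one_smul, add_sub_cancel]

theorem exists_contDiff_boundaryVec {P₁ : Matrix (Fin m) (Fin m) ℂ}
    {W_B W_C : Matrix (Fin m) (Fin m ⊕ Fin m) ℂ} (hab : a < b) (hP₁ : IsUnit P₁)
    (hW : (Matrix.fromBlocks 0 1 1 0 : Matrix (Fin m ⊕ Fin m) (Fin m ⊕ Fin m) ℂ) =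
      Matrix.fromRows W_B W_C * Matrix.fromBlocks 0 1 1 0 * (Matrix.fromRows W_B W_C)ᴴ)
    (u v : Cm m) : ∃ ζ : ℝ → Cm m, ContDiff ℝ 1 ζ ∧
      boundaryVec P₁ W_B (ζ b) (ζ a) = u ∧ boundaryVec P₁ W_C (ζ b) (ζ a) = v := by
  obtain ⟨zb, za, h1, h2⟩ := exists_boundaryVec_eq hW hP₁ u v
  obtain ⟨ζ, h3, rfl, rfl⟩ := exists_contDiff_boundary hab zb za
  exact ⟨ζ, h3, h1, h2⟩

theorem inv_sqrt_two_smul_sqrt_two_smul (u : Cm m) :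
    ((1 / √2 : ℝ) : ℂ) • ((√2 : ℝ) : ℂ) • u = u := by
  rw [smul_smul, ← Complex.ofReal_mul, one_div, inv_mul_cancel₀ (by positivity),
    Complex.ofReal_one, one_smul]

/-- The port operator is dissipative. -/
theorem re_supply_le_of_mem_portGraph (hab : a < b) {P₀ : ℝ → Matrix (Fin m) (Fin m) ℂ}
    (hP₀ : ∀ᵐ ξ ∂(intervalMeasure a b), ∀ v : Cm m, (⟪v, act (P₀ ξ) v⟫_ℂ).re ≤ 0)
    {P₁ : Matrix (Fin m) (Fin m) ℂ} (hP₁ : P₁.IsHermitian)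
    {W_B W_C : Matrix (Fin m) (Fin m ⊕ Fin m) ℂ}
    (hW : (Matrix.fromBlocks 0 1 1 0 : Matrix (Fin m ⊕ Fin m) (Fin m ⊕ Fin m) ℂ) =
      Matrix.fromRows W_B W_C * Matrix.fromBlocks 0 1 1 0 * (Matrix.fromRows W_B W_C)ᴴ)
    {q : WithLp 2 (L2 a b m × Cm m) × WithLp 2 (L2 a b m × Cm m)}
    (hq : q ∈ portGraph a b P₀ P₁ W_B W_C) :
    (∫ ξ, ⟪q.2.fst ξ, q.1.fst ξ⟫_ℂ ∂(intervalMeasure a b) + ⟪q.2.snd, q.1.snd⟫_ℂ).re ≤ 0 := by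
  obtain ⟨g, ζ, hS, hu, hf, hv⟩ := hq
  have hd := hS.hasL1Deriv hab
  have hg := integral_inner_act_add hW hab.le hP₁ hd hd
  have hgi := (hasL1Deriv_inner_act hab.le hP₁ hd hd).integrable
  have hfi := L2.integrable_inner (𝕜 := ℂ) q.2.fst q.1.fst
  -- The contribution of `P₀` is dropped by dissipativity. The remaining integrand `2 Re ζ* P₁ g` is
  -- that of Green's identity for `ζ` against itself; its boundary term `Re ⟪C, B⟫` is twice the
  -- negative of the real part of the output-input product, where the two factors `1 / √2` combine
  -- to `1 / 2`.
  have h1 : ∫ ξ, 2 * RCLike.re ⟪q.2.fst ξ, q.1.fst ξ⟫_ℂ ∂(intervalMeasure a b) ≤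
      ∫ ξ, RCLike.re (⟪ζ ξ, act P₁ (g ξ)⟫_ℂ + ⟪act P₁ (g ξ), ζ ξ⟫_ℂ) ∂(intervalMeasure a b) := by
    refine integral_mono_ae (hfi.re.const_mul 2) hgi.re ?_
    filter_upwards [hf, hS.ae_eq, hP₀] with ξ e1 e2 e3
    rw [e1, e2, inner_add_left, ← inner_conj_symm (ζ ξ) (act P₁ (g ξ)),
      ← inner_conj_symm (act (P₀ ξ) (ζ ξ)) (ζ ξ)]
    have := e3 (ζ ξ)
    simp only [map_add, RCLike.conj_re]
    change 2 * ((⟪ζ ξ, act (P₀ ξ) (ζ ξ)⟫_ℂ).re + _) ≤ _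
    linarith
  rw [integral_const_mul, integral_re hfi, integral_re hgi, hg] at h1
  rw [hu, hv, inner_neg_left, inner_smul_left, inner_smul_right, Complex.conj_ofReal, ← mul_assoc,
    inv_sqrt_two_mul_self, Complex.add_re, Complex.neg_re]
  set B := boundaryVec P₁ W_B (ζ b) (ζ a)
  set C := boundaryVec P₁ W_C (ζ b) (ζ a)
  have h2 : (1 / 2 : ℂ) = ((1 / 2 : ℝ) : ℂ) := by push_cast; rfl
  have h3 : (⟪B, C⟫_ℂ).re = (⟪C, B⟫_ℂ).re := by rw [← inner_conj_symm B C, Complex.conj_re]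
  rw [h2] at h1 ⊢
  rw [Complex.re_ofReal_mul]
  change _ ≤ (((1 / 2 : ℝ) : ℂ) * (⟪B, C⟫_ℂ + ⟪C, B⟫_ℂ)).re at h1
  rw [Complex.re_ofReal_mul, Complex.add_re, h3] at h1
  change 2 * (∫ ξ, ⟪q.2.fst ξ, q.1.fst ξ⟫_ℂ ∂(intervalMeasure a b)).re ≤ _ at h1
  linarith

/-- `C¹` functions realize the inputs of the adjoint of the port operator. -/
theorem mem_adjoint_domain_portOperator (hab : a < b) {P₀ : ℝ → Matrix (Fin m) (Fin m) ℂ}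
    (hP₀ : ∀ i j, MemLp (fun ξ => P₀ ξ i j) ⊤ (intervalMeasure a b))
    {P₁ : Matrix (Fin m) (Fin m) ℂ} (hP₁ : P₁.IsHermitian)
    {W_B W_C : Matrix (Fin m) (Fin m ⊕ Fin m) ℂ}
    (hW : (Matrix.fromBlocks 0 1 1 0 : Matrix (Fin m ⊕ Fin m) (Fin m ⊕ Fin m) ℂ) =
      Matrix.fromRows W_B W_C * Matrix.fromBlocks 0 1 1 0 * (Matrix.fromRows W_B W_C)ᴴ)
    {η : ℝ → Cm m} (hη : ContDiffOn ℝ 1 η (Icc a b)) {w : L2 a b m}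
    (hw : ∀ᵐ ξ ∂(intervalMeasure a b), w ξ = η ξ) :
    WithLp.toLp 2 (w, ((1 / √2 : ℝ) : ℂ) • boundaryVec P₁ W_B (η b) (η a)) ∈
      (portOperator a b P₀ P₁ W_B W_C).adjoint.domain := by
  have hc : ContinuousOn (derivWithin η (Icc a b)) (Icc a b) :=
    hη.continuousOn_derivWithin (uniqueDiffOn_Icc hab) le_rfl
  -- The formal adjoint: `k = P₀* η - P₁ η'`, with second component `+ C η / √2`. Green's identity
  -- makes it the value of the adjoint at the given pair.
  obtain ⟨k, hk, -⟩ := exists_L2_act_add (A := fun ξ => (P₀ ξ)ᴴ) (fun i j => (hP₀ j i).star)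
    (-P₁) hη.continuousOn hc
  refine LinearPMap.mem_adjoint_domain_of_exists _ ⟨WithLp.toLp 2
    (k, ((1 / √2 : ℝ) : ℂ) • boundaryVec P₁ W_C (η b) (η a)), fun x => ?_⟩
  have hx := (portOperator a b P₀ P₁ W_B W_C).mem_graph x
  rw [graph_portOperator hab] at hx
  obtain ⟨g, ζ, hS, hu, hf, hv⟩ := hx
  simp only at hu hf hv
  set f := (portOperator a b P₀ P₁ W_B W_C x).fst
  have hgreen := integral_inner_act_add hW hab.le hP₁ (hη.hasL1Deriv hab.le) (hS.hasL1Deriv hab)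
  have h1 : ⟪w, f⟫_ℂ - ⟪k, (x : WithLp 2 (L2 a b m × Cm m)).fst⟫_ℂ =
      ∫ ξ, (⟪η ξ, act P₁ (g ξ)⟫_ℂ + ⟪act P₁ (derivWithin η (Icc a b) ξ), ζ ξ⟫_ℂ)
        ∂(intervalMeasure a b) := by
    rw [L2.inner_def, L2.inner_def, ← integral_sub (L2.integrable_inner _ _)
      (L2.integrable_inner _ _)]
    refine integral_congr_ae ?_
    filter_upwards [hf, hS.ae_eq, hw, hk] with ξ e1 e2 e3 e4
    have e5 : act (-P₁) (derivWithin η (Icc a b) ξ) = -act P₁ (derivWithin η (Icc a b) ξ) := by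
      simp [act]
    rw [e1, e2, e3, e4, e5, inner_add_right, inner_add_left, inner_neg_left,
      inner_act_right (P₀ ξ)]
    ring
  rw [hgreen] at h1
  rw [WithLp.prod_inner_apply, WithLp.prod_inner_apply]
  change ⟪k, (x : WithLp 2 (L2 a b m × Cm m)).fst⟫_ℂ + ⟪((1 / √2 : ℝ) : ℂ) •
    boundaryVec P₁ W_C (η b) (η a), (x : WithLp 2 (L2 a b m × Cm m)).snd⟫_ℂ = ⟪w, f⟫_ℂ +
    ⟪((1 / √2 : ℝ) : ℂ) • boundaryVec P₁ W_B (η b) (η a), (portOperator a b P₀ P₁ W_B W_C x).snd⟫_ℂ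
  rw [hu, hv, inner_neg_right, inner_smul_left, inner_smul_left, inner_smul_right, inner_smul_right,
    Complex.conj_ofReal, ← mul_assoc, ← mul_assoc, inv_sqrt_two_mul_self]
  linear_combination -h1

/-! ### Density of `C¹₀` -/

theorem ae_eq_zero_of_integral_smul_eq_zero {f : ℝ → Cm m}
    (hf : Integrable f (intervalMeasure a b))
    (H : ∀ φ : ℝ → ℝ, ContDiff ℝ ∞ φ → HasCompactSupport φ → tsupport φ ⊆ Ioo a b →
      ∫ ξ, φ ξ • f ξ ∂(intervalMeasure a b) = 0) : ∀ᵐ ξ ∂(intervalMeasure a b), f ξ = 0 := by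
  have key : ∀ᵐ ξ ∂(volume : Measure ℝ), ξ ∈ Ioo a b → f ξ = 0 := by
    refine isOpen_Ioo.ae_eq_zero_of_integral_contDiff_smul_eq_zero
      (IntegrableOn.mono_set hf Ioo_subset_Icc_self).locallyIntegrableOn fun φ h1 h2 h3 => ?_
    rw [← setIntegral_eq_integral_of_forall_compl_eq_zero (s := Icc a b) fun ξ hξ => by
      rw [eq_zero_of_tsupport_subset (h3.trans Ioo_subset_Icc_self) hξ, zero_smul]]
    exact H φ h1 h2 h3
  change ∀ᵐ ξ ∂(volume.restrict (Icc a b)), f ξ = 0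
  rw [← restrict_Ioo_eq_restrict_Icc, ae_restrict_iff' measurableSet_Ioo]
  exact key

theorem C1Zero_subset_energySubmodule (D : HamiltonianDensity a b m) :
    C1Zero a b m ⊆ energySubmodule D := by
  rintro x ⟨ζ, hx, -, -⟩
  obtain ⟨K, hK⟩ := hx.exists_norm_le
  exact EnergySpace.mem_energySubmodule_of_bound D x hK

/-- `C¹₀` as a subspace of `X_h*`. -/
def c1ZeroSubmodule (D : HamiltonianDensity a b m) : Submodule ℂ (DualEnergySpace D) where
  carrier := {x | x.val ∈ C1Zero a b m}
  zero_mem' := ⟨0, isC1Rep_zero, rfl, rfl⟩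
  add_mem' := by
    rintro x y ⟨ζ, h1, h2, h3⟩ ⟨η, h1', h2', h3'⟩
    exact ⟨ζ + η, h1.add h1', by simp [h2, h2'], by simp [h3, h3']⟩
  smul_mem' := by
    rintro c x ⟨ζ, h1, h2, h3⟩
    exact ⟨c • ζ, h1.smul c, by simp [h2], by simp [h3]⟩

theorem exists_isC1Rep {ζ : ℝ → Cm m} (hζ : ContDiffOn ℝ 1 ζ (Icc a b)) :
    ∃ x : MeasFun a b m, IsC1Rep x ζ :=
  ⟨AEEqFun.mk ζ (hζ.continuousOn.aestronglyMeasurable measurableSet_Icc), hζ,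
    AEEqFun.coeFn_mk _ _⟩

theorem exists_dual_isC1Rep (D : HamiltonianDensity a b m) {ζ : ℝ → Cm m}
    (hζ : ContDiffOn ℝ 1 ζ (Icc a b)) : ∃ x : DualEnergySpace D, IsC1Rep x.val ζ := by
  obtain ⟨x, hx⟩ := exists_isC1Rep hζ
  obtain ⟨K, hK⟩ := hx.exists_norm_le
  exact ⟨⟨x, EnergySpace.mem_energySubmodule_of_bound _ x hK⟩, hx⟩

theorem contDiff_one_smul_const {φ : ℝ → ℝ} (hφ : ContDiff ℝ ∞ φ) (e : Cm m) :
    ContDiff ℝ 1 fun t => φ t • e :=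
  (hφ.of_le (by exact_mod_cast le_top)).smul contDiff_const

/-- For `x` orthogonal to `C¹₀`, the inner product of `X_h*` is the `L²` pairing with `X = R⁻¹ x`,
which is integrable as an element of `X_h`. Testing with `φ e`, where `φ` is a test function and `e`
a constant vector, gives `∫ φ X = 0` and hence `X = 0`. -/
theorem dense_c1ZeroSubmodule (D : HamiltonianDensity a b m) :
    Dense (c1ZeroSubmodule D : Set (DualEnergySpace D)) := by
  refine Submodule.dense_of_forall_inner_eq_zero _ fun x hx => ?_
  set X := (riesz D).symm x with hX
  have hi := EnergySpace.integrable_val X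
  suffices h : X = 0 by
    rw [hX] at h
    exact (map_eq_zero_iff _ (riesz D).symm.injective).1 h
  refine EnergySpace.eq_zero_of_ae (ae_eq_zero_of_integral_smul_eq_zero hi fun φ h1 h2 h3 => ?_)
  refine ext_inner_left ℂ fun e => ?_
  have hφi : Integrable (fun ξ => φ ξ • X.val ξ) (intervalMeasure a b) :=
    IntegrableOn.continuousOn_smul hi h1.continuous.continuousOn isCompact_Icc
  obtain ⟨y, hy⟩ := exists_dual_isC1Rep D (contDiff_one_smul_const h1 e).contDiffOn
  have h4 := hx y ⟨_, hy, by simp [eq_zero_of_tsupport_subset h3 (x := a) (by simp)],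
    by simp [eq_zero_of_tsupport_subset h3 (x := b) (by simp)]⟩
  rw [← (riesz D).symm.inner_map_map, ← hX, ← EnergySpace.pairing_eq_inner] at h4
  rw [← integral_inner hφi, inner_zero_right, ← map_zero (starRingEnd ℂ), ← h4]
  change _ = (starRingEnd ℂ) (∫ ξ, ⟪X.val ξ, y.val ξ⟫_ℂ ∂(intervalMeasure a b))
  rw [← integral_conj]
  refine integral_congr_ae ?_
  filter_upwards [hy.ae_eq] with ξ e1
  rw [e1, inner_conj_symm, inner_smul_left_eq_smul, inner_smul_right_eq_smul]

/-! ### The range condition -/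

/-- A weak solution `w ∈ L¹` of `P₁ w' = P₀* w - x`, tested against all of `W`, satisfies
`Re ∫ w* x ≤ 0`. -/
theorem integral_re_inner_le_of_weak (hab : a < b) {P₀ : ℝ → Matrix (Fin m) (Fin m) ℂ}
    (hP₀ : ∀ i j, MemLp (fun ξ => P₀ ξ i j) ⊤ (intervalMeasure a b))
    (hP₀_diss : ∀ᵐ ξ ∂(intervalMeasure a b), ∀ v : Cm m, (⟪v, act (P₀ ξ) v⟫_ℂ).re ≤ 0)
    {P₁ : Matrix (Fin m) (Fin m) ℂ} (hP₁ : P₁.IsHermitian) (hP₁_inv : IsUnit P₁)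
    {W_B W_C : Matrix (Fin m) (Fin m ⊕ Fin m) ℂ}
    (hW : (Matrix.fromBlocks 0 1 1 0 : Matrix (Fin m ⊕ Fin m) (Fin m ⊕ Fin m) ℂ) =
      Matrix.fromRows W_B W_C * Matrix.fromBlocks 0 1 1 0 * (Matrix.fromRows W_B W_C)ᴴ)
    {w x : ℝ → Cm m} (hw : Integrable w (intervalMeasure a b))
    (hx : Integrable x (intervalMeasure a b))
    (hwx : Integrable (fun ξ => ⟪w ξ, x ξ⟫_ℂ) (intervalMeasure a b))
    (H : ∀ ζ : ℝ → Cm m, ContDiffOn ℝ 1 ζ (Icc a b) → boundaryVec P₁ W_B (ζ b) (ζ a) = 0 →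
      ∫ ξ, (⟪w ξ, act P₁ (derivWithin ζ (Icc a b) ξ)⟫_ℂ + ⟪act (P₀ ξ)ᴴ (w ξ) - x ξ, ζ ξ⟫_ℂ)
        ∂(intervalMeasure a b) = 0) :
    (∫ ξ, ⟪w ξ, x ξ⟫_ℂ ∂(intervalMeasure a b)).re ≤ 0 := by
  have hdet := (Matrix.isUnit_iff_isUnit_det _).1 hP₁_inv
  set h : ℝ → Cm m := fun ξ => act (P₀ ξ)ᴴ (w ξ) - x ξ with hh
  have hint : Integrable h (intervalMeasure a b) := by
    obtain ⟨K, -, hK⟩ := exists_norm_act_le (A := fun ξ => (P₀ ξ)ᴴ) (fun i j => (hP₀ j i).star)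
    refine Integrable.sub ((hw.norm.const_mul K).mono' (aestronglyMeasurable_act
      (fun i j => (hP₀ j i).star.1) hw.1) ?_) hx
    filter_upwards [hK] with ξ e using e _
  have hPw : Integrable (fun ξ => act P₁ (w ξ)) (intervalMeasure a b) :=
    (Matrix.toEuclideanCLM (n := Fin m) (𝕜 := ℂ) P₁).integrable_comp hw
  -- The functions `φ e` have zero boundary values, so `H` applies to them and says that `P₁ w` has
  -- weak derivative `h = P₀* w - x`. Only `h ∈ L¹` is available, since `w` need not be square
  -- integrable.
  obtain ⟨F, hF, hwF⟩ := exists_hasL1Deriv_of_integral_deriv_smul hab hPw hint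
    fun φ h1 h2 h3 => by
      have hd : Continuous (deriv φ) := h1.continuous_deriv (by simp)
      have i1 : Integrable (fun ξ => deriv φ ξ • act P₁ (w ξ)) (intervalMeasure a b) :=
        IntegrableOn.continuousOn_smul hPw hd.continuousOn isCompact_Icc
      have i2 : Integrable (fun ξ => φ ξ • h ξ) (intervalMeasure a b) :=
        IntegrableOn.continuousOn_smul hint h1.continuous.continuousOn isCompact_Icc
      have i3 : Integrable (fun ξ => deriv φ ξ • act P₁ (w ξ) + φ ξ • h ξ) (intervalMeasure a b) :=
        i1.add i2
      rw [eq_neg_iff_add_eq_zero, ← integral_add i1 i2]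
      refine ext_inner_left ℂ fun e => ?_
      have hφe := contDiff_one_smul_const h1 e
      have h4 := H (fun t => φ t • e) hφe.contDiffOn (by
        simpa [eq_zero_of_tsupport_subset h3 (x := a) (by simp),
          eq_zero_of_tsupport_subset h3 (x := b) (by simp)] using boundaryVec_smul P₁ W_B 0 0 0)
      rw [← integral_inner i3, inner_zero_right, ← map_zero (starRingEnd ℂ), ← h4,
        ← integral_conj]
      refine integral_congr_ae ?_
      filter_upwards [ae_restrict_mem measurableSet_Icc] with ξ hξ
      have hder : derivWithin (fun t => φ t • e) (Icc a b) ξ = deriv φ ξ • e :=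
        (((h1.differentiable (by simp) ξ).hasDerivAt.smul_const e).hasDerivWithinAt).derivWithin
          (uniqueDiffOn_Icc hab ξ hξ)
      rw [hder, inner_act_right, hP₁.eq, map_add, inner_conj_symm, inner_conj_symm,
        inner_smul_left_eq_smul, inner_smul_left_eq_smul, inner_add_right,
        inner_smul_right_eq_smul, inner_smul_right_eq_smul]
  -- the absolutely continuous representative of `w`
  set v : ℝ → Cm m := fun ξ => act P₁⁻¹ (F ξ) with hv
  have hvd : HasL1Deriv a b v (fun ξ => act P₁⁻¹ (h ξ)) := hF.clm_comp hab.le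
    ((Matrix.toEuclideanCLM (n := Fin m) (𝕜 := ℂ) P₁⁻¹).restrictScalars ℝ)
  have hPP : ∀ y : Cm m, act P₁ (act P₁⁻¹ y) = y := fun y => by
    rw [← act_mul, Matrix.mul_nonsing_inv _ hdet, act_one]
  have hwv : ∀ᵐ ξ ∂(intervalMeasure a b), w ξ = v ξ := hwF.mono fun ξ e => by
    rw [hv]
    simp only
    rw [← e, ← act_mul, Matrix.nonsing_inv_mul _ hdet, act_one]
  -- its boundary values
  have hBv : boundaryVec P₁ W_B (v b) (v a) = 0 := by
    -- A test function with `B ζ = 0` and `C ζ = B v` is admissible in `H`, and Green's identity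
    -- reduces the resulting equation to `‖B v‖² / 2 = 0`.
    obtain ⟨ζ, hζ, hB, hC⟩ := exists_contDiff_boundaryVec hab hP₁_inv hW 0
      (boundaryVec P₁ W_B (v b) (v a))
    have h1 := integral_inner_act_add hW hab.le hP₁ hvd (hζ.contDiffOn.hasL1Deriv hab.le)
    rw [hB, hC, inner_zero_right, add_zero] at h1
    have h2 := H ζ hζ.contDiffOn hB
    have h3 : (1 / 2 : ℂ) * ⟪boundaryVec P₁ W_B (v b) (v a), boundaryVec P₁ W_B (v b) (v a)⟫_ℂ =
        0 := by
      rw [← h1, ← h2]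
      refine integral_congr_ae (hwv.mono fun ξ e => ?_)
      simp only [hPP, hh, e]
    simpa using h3
  have hgi := (hasL1Deriv_inner_act hab.le hP₁ hvd hvd).integrable
  -- Each boundary term for `v` against itself contains a factor `B v = 0`, so `Re ∫ v* h = 0`.
  have h1 := integral_inner_act_add hW hab.le hP₁ hvd hvd
  rw [hBv, inner_zero_left, inner_zero_right, add_zero, mul_zero] at h1
  have h2 : ∫ ξ, 2 * RCLike.re ⟪w ξ, x ξ⟫_ℂ ∂(intervalMeasure a b) ≤
      ∫ ξ, -RCLike.re (⟪v ξ, act P₁ (act P₁⁻¹ (h ξ))⟫_ℂ + ⟪act P₁ (act P₁⁻¹ (h ξ)), v ξ⟫_ℂ)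
        ∂(intervalMeasure a b) := by
    refine integral_mono_ae (hwx.re.const_mul 2) hgi.re.neg ?_
    filter_upwards [hwv, hP₀_diss] with ξ e1 e2
    have e3 := e2 (w ξ)
    rw [hPP, ← e1, ← inner_conj_symm (h ξ) (w ξ), hh]
    simp only [map_add, RCLike.conj_re, inner_sub_right, map_sub]
    rw [inner_act_right, Matrix.conjTranspose_conjTranspose,
      ← inner_conj_symm (act (P₀ ξ) (w ξ)) (w ξ), RCLike.conj_re]
    change _ ≤ -((⟪w ξ, act (P₀ ξ) (w ξ)⟫_ℂ).re - _ + ((⟪w ξ, act (P₀ ξ) (w ξ)⟫_ℂ).re - _))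
    linarith
  rw [integral_neg, integral_re hgi, h1, integral_const_mul, integral_re hwx] at h2
  change 2 * (∫ ξ, ⟪w ξ, x ξ⟫_ℂ ∂(intervalMeasure a b)).re ≤ -(0 : ℂ).re at h2
  rw [Complex.zero_re, neg_zero] at h2
  linarith

theorem mem_graph_mainOperator_iff {X X' U : Type*} [NormedAddCommGroup X]
    [InnerProductSpace ℂ X] [NormedAddCommGroup X'] [InnerProductSpace ℂ X']
    [NormedAddCommGroup U] [InnerProductSpace ℂ U] (M : NodeOp X' X U) (z : X') (f : X) :
    (z, f) ∈ (mainOperator M).graph ↔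
      ∃ v : U, (WithLp.toLp 2 (z, (0 : U)), WithLp.toLp 2 (f, v)) ∈ M.graph := by
  constructor
  · intro h
    obtain ⟨y, h1, h2⟩ := (LinearPMap.mem_graph_iff _).1 h
    refine ⟨(M ⟨WithLp.toLp 2 ((y : X'), (0 : U)), y.2⟩).snd, ?_⟩
    have h1' : (y : X') = z := h1
    have h2' : (M ⟨WithLp.toLp 2 ((y : X'), (0 : U)), y.2⟩).fst = f := h2
    rw [← h1', ← h2']
    exact M.mem_graph ⟨WithLp.toLp 2 ((y : X'), (0 : U)), y.2⟩
  · rintro ⟨v, h⟩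
    have hm : WithLp.toLp 2 (z, (0 : U)) ∈ M.domain := LinearPMap.mem_domain_of_mem_graph h
    refine (LinearPMap.mem_graph_iff _).2 ⟨⟨z, hm⟩, rfl, ?_⟩
    obtain ⟨y, h1, h2⟩ := (LinearPMap.mem_graph_iff _).1 h
    have h3 : M ⟨_, hm⟩ = WithLp.toLp 2 (f, v) := by
      refine Eq.trans ?_ h2
      congr 1
      exact Subtype.ext h1.symm
    exact congrArg WithLp.fst h3

/-- The range of `F - R⁻¹` on `W`, as a subspace of `X_h`. -/
def rangeSubmodule (D : HamiltonianDensity a b m) (P₁ : Matrix (Fin m) (Fin m) ℂ)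
    (W_B : Matrix (Fin m) (Fin m ⊕ Fin m) ℂ) (T : L2 a b m →ₗ.[ℂ] L2 a b m) :
    Submodule ℂ (EnergySpace D) where
  carrier := {y | ∃ x ∈ homogeneousC1 D P₁ W_B, ∃ z f : L2 a b m, (z, f) ∈ T.graph ∧
    (z : MeasFun a b m) = x.val ∧ y.val = (f : MeasFun a b m) - ((riesz D).symm x).val}
  zero_mem' := by
    refine ⟨0, ⟨0, isC1Rep_zero, ?_⟩, 0, 0, T.graph.zero_mem, rfl, ?_⟩
    · simpa using boundaryVec_smul P₁ W_B 0 0 0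
    · rw [map_zero]
      exact (sub_zero (0 : MeasFun a b m)).symm
  add_mem' := by
    rintro y y' ⟨x, ⟨ζ, h1, h2⟩, z, f, h3, h4, h5⟩ ⟨x', ⟨ζ', h1', h2'⟩, z', f', h3', h4', h5'⟩
    refine ⟨x + x', ⟨ζ + ζ', h1.add h1', ?_⟩, z + z', f + f', T.graph.add_mem h3 h3', ?_, ?_⟩
    · rw [Pi.add_apply, Pi.add_apply, boundaryVec_add, h2, h2', add_zero]
    · exact congrArg₂ (· + ·) h4 h4'
    · rw [EnergySpace.val_add, h5, h5', map_add, EnergySpace.val_add]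
      change _ = (f : MeasFun a b m) + (f' : MeasFun a b m) - _
      abel
  smul_mem' := by
    rintro c y ⟨x, ⟨ζ, h1, h2⟩, z, f, h3, h4, h5⟩
    refine ⟨c • x, ⟨c • ζ, h1.smul c, ?_⟩, c • z, c • f, T.graph.smul_mem c h3, ?_, ?_⟩
    · rw [Pi.smul_apply, Pi.smul_apply, boundaryVec_smul, h2, smul_zero]
    · exact congrArg (c • ·) h4
    · rw [EnergySpace.val_smul, h5, map_smul, EnergySpace.val_smul, smul_sub]
      rfl

/-- Boundedness of `P₀` keeps `P₀ ζ + P₁ ζ'` bounded, and bounded functions lie in every energy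
space; the homogeneous boundary condition is the zero input. -/
theorem exists_mem_graph_mainOperator (hab : a < b) (D : HamiltonianDensity a b m)
    {P₀ : ℝ → Matrix (Fin m) (Fin m) ℂ}
    (hP₀ : ∀ i j, MemLp (fun ξ => P₀ ξ i j) ⊤ (intervalMeasure a b))
    (P₁ : Matrix (Fin m) (Fin m) ℂ) (W_B W_C : Matrix (Fin m) (Fin m ⊕ Fin m) ℂ)
    {x : MeasFun a b m} {ζ : ℝ → Cm m} (hx : IsC1Rep x ζ)
    (hB : boundaryVec P₁ W_B (ζ b) (ζ a) = 0) :
    ∃ z f : L2 a b m, (z, f) ∈ (mainOperator (portOperator a b P₀ P₁ W_B W_C)).graph ∧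
      (z : MeasFun a b m) = x ∧ (f : MeasFun a b m) ∈ energySubmodule D ∧
      ∀ᵐ ξ ∂(intervalMeasure a b),
        f ξ = act (P₀ ξ) (ζ ξ) + act P₁ (derivWithin ζ (Icc a b) ξ) := by
  obtain ⟨z, f, hz, hf, ⟨K, hK⟩, hg⟩ := exists_mem_portGraph hab hP₀ P₁ W_B W_C hx.contDiffOn
  refine ⟨z, f, ?_, ?_, EnergySpace.mem_energySubmodule_of_bound D _ hK, hf⟩
  · rw [mem_graph_mainOperator_iff, graph_portOperator hab]
    rw [hB, smul_zero] at hg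
    exact ⟨_, hg⟩
  · apply AEEqFun.ext
    filter_upwards [hz, hx.ae_eq] with ξ h1 h2
    rw [h1, h2]

/-- Orthogonality of `x` to the range is, for `w = H x`, the weak equation of
`integral_re_inner_le_of_weak`. Its conclusion is `‖x‖² ≤ 0`, because `∫ (H x)* x` is the squared
norm of `x` in `X_h`. -/
theorem dense_rangeSubmodule (hab : a < b) (D : HamiltonianDensity a b m)
    {P₀ : ℝ → Matrix (Fin m) (Fin m) ℂ}
    (hP₀ : ∀ i j, MemLp (fun ξ => P₀ ξ i j) ⊤ (intervalMeasure a b))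
    (hP₀_diss : ∀ᵐ ξ ∂(intervalMeasure a b), ∀ v : Cm m, (⟪v, act (P₀ ξ) v⟫_ℂ).re ≤ 0)
    {P₁ : Matrix (Fin m) (Fin m) ℂ} (hP₁ : P₁.IsHermitian) (hP₁_inv : IsUnit P₁)
    {W_B W_C : Matrix (Fin m) (Fin m ⊕ Fin m) ℂ}
    (hW : (Matrix.fromBlocks 0 1 1 0 : Matrix (Fin m ⊕ Fin m) (Fin m ⊕ Fin m) ℂ) =
      Matrix.fromRows W_B W_C * Matrix.fromBlocks 0 1 1 0 * (Matrix.fromRows W_B W_C)ᴴ) :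
    Dense (rangeSubmodule D P₁ W_B (mainOperator (portOperator a b P₀ P₁ W_B W_C)) :
      Set (EnergySpace D)) := by
  refine Submodule.dense_of_forall_inner_eq_zero _ fun x hx => ?_
  -- This supplies integrability of `(H x)* x`, which does not follow from `x` and `H x` being
  -- integrable.
  have hself : ∀ᵐ ξ ∂(intervalMeasure a b),
      ⟪x.toL2Fun ξ, x.toL2Fun ξ⟫_ℂ = ⟪(riesz D x).val ξ, x.val ξ⟫_ℂ := by
    filter_upwards [x.toL2Fun_eq, riesz_val D x, D.posDef] with ξ e1 e2 hp
    rw [e1, e2, act_eq_sqrt hp, inner_act_left (CFC.sqrt (D.toFun ξ)) (act _ _),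
      sqrt_conjTranspose]
  have key := integral_re_inner_le_of_weak hab hP₀ hP₀_diss hP₁ hP₁_inv hW
    (EnergySpace.integrable_val (riesz D x)) (EnergySpace.integrable_val x)
    ((L2.integrable_inner (𝕜 := ℂ) x.toL2Fun x.toL2Fun).congr hself) fun ζ hζ hB => by
      obtain ⟨x', hx'⟩ := exists_dual_isC1Rep D hζ
      obtain ⟨z, f, h1, h2, h3, h4⟩ :=
        exists_mem_graph_mainOperator hab D hP₀ P₁ W_B W_C hx' hB
      let y : EnergySpace D := ⟨f, h3⟩
      have h5 := hx (y - (riesz D).symm x') ⟨x', ⟨ζ, hx', hB⟩, z, f, h1, h2, rfl⟩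
      rw [EnergySpace.inner_eq_integral_riesz] at h5
      rw [← h5]
      refine integral_congr_ae ?_
      filter_upwards [EnergySpace.coe_sub y ((riesz D).symm x'), h4, hx'.ae_eq,
        EnergySpace.inner_riesz_riesz_symm x x'] with ξ e1 e2 e3 e4
      change y.val ξ = _ at e2
      rw [e1, inner_sub_right, e4, e2, e3, inner_add_right, inner_sub_left, inner_act_right (P₀ ξ)]
      ring
  rw [← EnergySpace.inner_eq_integral_riesz] at key
  have h1 : ‖x‖ ^ 2 ≤ 0 := by rw [@norm_sq_eq_re_inner ℂ]; exact key
  exact norm_eq_zero.1 (pow_eq_zero_iff two_ne_zero |>.1 (le_antisymm h1 (sq_nonneg _)))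

/-! ### The restricted operator -/

theorem exists_mem_restrictGraph (hab : a < b) (D : HamiltonianDensity a b m)
    {P₀ : ℝ → Matrix (Fin m) (Fin m) ℂ}
    (hP₀ : ∀ i j, MemLp (fun ξ => P₀ ξ i j) ⊤ (intervalMeasure a b))
    (P₁ : Matrix (Fin m) (Fin m) ℂ) (W_B W_C : Matrix (Fin m) (Fin m ⊕ Fin m) ℂ)
    {x : DualEnergySpace D} {ζ : ℝ → Cm m} (hx : IsC1Rep x.val ζ) :
    WithLp.toLp 2 (x, ((1 / √2 : ℝ) : ℂ) • boundaryVec P₁ W_B (ζ b) (ζ a)) ∈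
      (restrictOperator D (portOperator a b P₀ P₁ W_B W_C)).domain := by
  obtain ⟨z, f, hz, hf, ⟨K, hK⟩, hg⟩ := exists_mem_portGraph hab hP₀ P₁ W_B W_C hx.contDiffOn
  rw [← graph_portOperator hab] at hg
  refine LinearPMap.mem_domain_of_mem_graph (y := WithLp.toLp 2
    ((⟨f, EnergySpace.mem_energySubmodule_of_bound D _ hK⟩ : EnergySpace D),
      -(((1 / √2 : ℝ) : ℂ) • boundaryVec P₁ W_C (ζ b) (ζ a)))) ?_
  rw [graph_restrictOperator]
  refine ⟨_, hg, ?_, rfl, rfl, rfl⟩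
  apply AEEqFun.ext
  filter_upwards [hz, hx.ae_eq] with ξ h1 h2
  exact h1.trans h2.symm

/-- The domain contains `C¹₀ × {0}`, whose density in `X_h*` kills the state component of an
orthogonal vector; the attainable inputs then kill the other component. -/
theorem dense_domain_restrictOperator (hab : a < b) (D : HamiltonianDensity a b m)
    {P₀ : ℝ → Matrix (Fin m) (Fin m) ℂ}
    (hP₀ : ∀ i j, MemLp (fun ξ => P₀ ξ i j) ⊤ (intervalMeasure a b))
    (P₁ : Matrix (Fin m) (Fin m) ℂ) (W_B W_C : Matrix (Fin m) (Fin m ⊕ Fin m) ℂ)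
    (hU : ∀ u : Cm m, ∃ x : DualEnergySpace D, WithLp.toLp 2 (x, u) ∈
      (restrictOperator D (portOperator a b P₀ P₁ W_B W_C)).domain) :
    Dense ((restrictOperator D (portOperator a b P₀ P₁ W_B W_C)).domain :
      Set (WithLp 2 (DualEnergySpace D × Cm m))) := by
  refine Submodule.dense_of_forall_inner_eq_zero _ fun w hw => ?_
  have h1 : w.fst = 0 := by
    refine (dense_c1ZeroSubmodule D).eq_zero_of_inner_left (𝕜 := ℂ) fun v hv => ?_
    obtain ⟨ζ, h1, h2, h3⟩ := hv
    have h4 := hw _ (exists_mem_restrictGraph hab D hP₀ P₁ W_B W_C h1)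
    rw [WithLp.prod_inner_apply, h2, h3] at h4
    have h5 : boundaryVec P₁ W_B (0 : Cm m) 0 = 0 := by
      simpa using boundaryVec_smul P₁ W_B 0 0 0
    rw [h5, smul_zero] at h4
    change ⟪w.fst, v⟫_ℂ + ⟪w.snd, (0 : Cm m)⟫_ℂ = 0 at h4
    rwa [inner_zero_right, add_zero] at h4
  have h2 : w.snd = 0 := by
    obtain ⟨x, hx⟩ := hU w.snd
    have h4 := hw _ hx
    rw [WithLp.prod_inner_apply] at h4
    change ⟪w.fst, x⟫_ℂ + ⟪w.snd, w.snd⟫_ℂ = 0 at h4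
    rwa [h1, inner_zero_left, zero_add, inner_self_eq_zero] at h4
  rw [← WithLp.toLp_ofLp 2 w]
  have : w.ofLp = 0 := Prod.ext h1 h2
  rw [this]; rfl

end PHNode

end

/-! ### Assembly of the theorem -/

theorem mainTheorem11 {a b : ℝ} (hab : a < b) {m : ℕ}
    (D : PHNode.HamiltonianDensity a b m)
    (P₀ : ℝ → Matrix (Fin m) (Fin m) ℂ)
    (hP₀_bdd : ∀ i j, MemLp (fun ξ => P₀ ξ i j) ⊤ (PHNode.intervalMeasure a b))
    (hP₀_diss : ∀ᵐ ξ ∂(PHNode.intervalMeasure a b), ∀ v : PHNode.Cm m,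
      (⟪v, PHNode.act (P₀ ξ) v⟫_ℂ).re ≤ 0)
    (P₁ : Matrix (Fin m) (Fin m) ℂ) (hP₁_herm : P₁.IsHermitian) (hP₁_inv : IsUnit P₁)
    (W_B W_C : Matrix (Fin m) (Fin m ⊕ Fin m) ℂ)
    (hW : (Matrix.fromBlocks 0 1 1 0 : Matrix (Fin m ⊕ Fin m) (Fin m ⊕ Fin m) ℂ) =
      Matrix.fromRows W_B W_C * Matrix.fromBlocks 0 1 1 0 * (Matrix.fromRows W_B W_C)ᴴ) :
    let M := PHNode.portOperator a b P₀ P₁ W_B W_C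
    -- boundary inputs are realized by `C¹` functions in the domain of `M`
    (∀ u : PHNode.Cm m, ∃ z : PHNode.L2 a b m,
      (z : PHNode.MeasFun a b m) ∈ PHNode.C1 a b m ∧ WithLp.toLp 2 (z, u) ∈ M.domain) ∧
    -- and likewise for the Hilbert space adjoint of `M`
    (∀ y : PHNode.Cm m, ∃ w : PHNode.L2 a b m,
      (w : PHNode.MeasFun a b m) ∈ PHNode.C1 a b m ∧ WithLp.toLp 2 (w, y) ∈ M.adjoint.domain) ∧
    -- `C¹₀` is contained in `X_h*`, and it is dense there
    (PHNode.C1Zero a b m ⊆ PHNode.energySubmodule D.inv ∧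
      Dense {x : PHNode.DualEnergySpace D | x.val ∈ PHNode.C1Zero a b m}) ∧
    -- `F - R⁻¹` is defined on `W`, maps it into `X_h`, and the image is dense in `X_h`
    ((∀ x ∈ PHNode.homogeneousC1 D P₁ W_B, ∃ z f : PHNode.L2 a b m,
        (z, f) ∈ (PHNode.mainOperator M).graph ∧ (z : PHNode.MeasFun a b m) = x.val ∧
        (f : PHNode.MeasFun a b m) ∈ PHNode.energySubmodule D) ∧
      Dense {y : PHNode.EnergySpace D | ∃ x ∈ PHNode.homogeneousC1 D P₁ W_B,
        ∃ z f : PHNode.L2 a b m, (z, f) ∈ (PHNode.mainOperator M).graph ∧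
          (z : PHNode.MeasFun a b m) = x.val ∧
          y.val = (f : PHNode.MeasFun a b m) - ((PHNode.riesz D).symm x).val}) ∧
    -- the restriction of `M` is closable and its closure is a dissipation node
    ((PHNode.restrictOperator D M).IsClosable ∧
      PHNode.IsDissipationNode (PHNode.energyAntiDual D)
        (PHNode.restrictOperator D M).closure) := by
  intro M
  have hdom : ∀ {p : WithLp 2 (PHNode.L2 a b m × PHNode.Cm m)}
      {q : WithLp 2 (PHNode.L2 a b m × PHNode.Cm m)},
      (p, q) ∈ PHNode.portGraph a b P₀ P₁ W_B W_C → p ∈ M.domain := fun h => by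
    rw [← PHNode.graph_portOperator hab] at h
    exact LinearPMap.mem_domain_of_mem_graph h
  have hinput : ∀ u : PHNode.Cm m, ∃ ζ : ℝ → PHNode.Cm m, ContDiffOn ℝ 1 ζ (Icc a b) ∧
      ((1 / √2 : ℝ) : ℂ) • PHNode.boundaryVec P₁ W_B (ζ b) (ζ a) = u := fun u => by
    -- The factor `√2` compensates the normalization `1 / √2` of the input.
    obtain ⟨ζ, h1, h2, -⟩ := PHNode.exists_contDiff_boundaryVec hab hP₁_inv hW
      (((√2 : ℝ) : ℂ) • u) 0
    exact ⟨ζ, h1.contDiffOn, by rw [h2, PHNode.inv_sqrt_two_smul_sqrt_two_smul]⟩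
  have hU : ∀ u : PHNode.Cm m, ∃ x : PHNode.DualEnergySpace D,
      WithLp.toLp 2 (x, u) ∈ (PHNode.restrictOperator D M).domain := fun u => by
    obtain ⟨ζ, hζ, rfl⟩ := hinput u
    obtain ⟨x, hx⟩ := PHNode.exists_dual_isC1Rep D hζ
    exact ⟨x, PHNode.exists_mem_restrictGraph hab D hP₀_bdd P₁ W_B W_C hx⟩
  have hrange := PHNode.dense_rangeSubmodule hab D hP₀_bdd hP₀_diss hP₁_herm hP₁_inv hW
  refine ⟨fun u => ?_, fun y => ?_, ⟨PHNode.C1Zero_subset_energySubmodule D.inv,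
    PHNode.dense_c1ZeroSubmodule D⟩, ⟨fun x hx => ?_, hrange⟩, ?_⟩
  · obtain ⟨ζ, hζ, rfl⟩ := hinput u
    obtain ⟨z, f, hz, -, -, hg⟩ := PHNode.exists_mem_portGraph hab hP₀_bdd P₁ W_B W_C hζ
    exact ⟨z, ⟨ζ, hζ, hz⟩, hdom hg⟩
  · obtain ⟨η, hη, rfl⟩ := hinput y
    obtain ⟨w, hw⟩ := PHNode.exists_L2_eq_of_continuousOn hη.continuousOn
    exact ⟨w, ⟨η, hη, hw⟩, PHNode.mem_adjoint_domain_portOperator hab hP₀_bdd hP₁_herm hW hη hw⟩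
  · obtain ⟨ζ, h1, h2⟩ := hx
    obtain ⟨z, f, h3, h4, h5, -⟩ :=
      PHNode.exists_mem_graph_mainOperator hab D hP₀_bdd P₁ W_B W_C h1 h2
    exact ⟨z, f, h3, h4, h5⟩
  · refine PHNode.isDissipationNode_closure _ _
      (PHNode.dense_domain_restrictOperator hab D hP₀_bdd P₁ W_B W_C hU) ?_ hU
      (hrange.mono ?_)
    · intro p hp
      rw [PHNode.graph_restrictOperator] at hp
      obtain ⟨q, hq, h1, h2, h3, h4⟩ := hp
      rw [PHNode.graph_portOperator hab] at hq
      rw [PHNode.AntiDual.inner_prodIso]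
      -- The duality product is an integral with respect to the pivot space, and the restricted
      -- graph consists of the same functions as the graph of `M`; dissipativity is therefore
      -- inherited.
      change (∫ ξ, ⟪p.2.fst.val ξ, p.1.fst.val ξ⟫_ℂ ∂(PHNode.intervalMeasure a b)
        + ⟪p.2.snd, p.1.snd⟫_ℂ).re ≤ 0
      rw [← h1, ← h2, ← h3, ← h4]
      exact PHNode.re_supply_le_of_mem_portGraph hab hP₀_diss hP₁_herm hW hq
    · rintro y ⟨x, -, z, f, h1, h2, h3⟩
      obtain ⟨v, hv⟩ := (PHNode.mem_graph_mainOperator_iff M z f).1 h1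
      -- From `y = F x - R⁻¹ x`, the element `y + R⁻¹ x` of `X_h` is represented by the function `F
      -- x`.
      refine ⟨x, WithLp.toLp 2 (y + (PHNode.riesz D).symm x, v), ?_, (add_sub_cancel_right _ _).symm⟩
      rw [PHNode.graph_restrictOperator]
      refine ⟨_, hv, h2, rfl, ?_, rfl⟩
      change (f : PHNode.MeasFun a b m) = (y + (PHNode.riesz D).symm x).val
      rw [PHNode.EnergySpace.val_add, h3, sub_add_cancel]
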